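/- **Setting.** A (finite-horizon) Dec-POMDP $D$ consists of agents $\mathcal N=\{1,\dots,N\}$ ($N\ge 1$), a finite set $\mathcal S$ of states, finite non-empty sets $\mathcal A_i$ of actions and finite sets $\mathcal O_i$ of observations ($i\in\mathcal N$; $\mathcal A=\prod_i\mathcal A_i$, $\mathcal O=\prod_i\mathcal O_i$), kernels $P:\mathcal S\times\mathcal A\to\Delta(\mathcal S)$ and $O:\mathcal S\times\mathcal A\to\Delta(\mathcal O)$, a reward function $\mathcal R:\mathcal S\times\mathcal A\to\mathbb R$, an initial distribution $b_0\in\Delta(\mathcal S)$ and a horizon $T\ge 0$. A local policy $\pi_i$ maps every action-observation history in $\bigcup_{t\le T}(\mathcal A_i\times\mathcal O_i)^t$ to a distribution on $\mathcal A_i$; $\Pi^D$ is the set of joint policies $\pi=(\pi_i)_i$. Under $\mathbb P_\pi$: $S_0\sim b_0$, $A_{i,t}\sim\pi_i(\cdot\mid AO_{i,t})$ with $AO_{i,t}=(A_{i,0},O_{i,1},\dots,A_{i,t-1},O_{i,t})$, $R_t=\mathcal R(S_t,A_t)$, $S_{t+1}\sim P(\cdot\mid S_t,A_t)$, $O_{t+1}\sim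 O(\cdot\mid S_{t+1},A_t)$. The history $H=(S_t,A_t,R_t)_{0\le t\le T},(O_t)_{1\le t\le T}$ has values in the finite set $\mathcal H^D$ (rewards ranging over the values of $\mathcal R$), and $J^D(\pi)=\mathbb E_\pi[\sum_{t=0}^T R_t]$. An isomorphism $f\in\mathrm{Iso}(D,E)$ (where $T^D=T^E$) is a tuple of bijections $f_N:\mathcal N^D\to\mathcal N^E$, $f_S:\mathcal S^D\to\mathcal S^E$, $f_{A_i}:\mathcal A_i^D\to\mathcal A^E_{f_N(i)}$, $f_{O_i}:\mathcal O_i^D\to\mathcal O^E_{f_N(i)}$ that preserves $P,O,\mathcal R,b_0$, where $(fa)_{f_N(i)}=f_{A_i}(a_i)$ for joint actions, likewise for joint observations; it acts element-wise on histories and fixes rewards. $\mathrm{Aut}(D)=\mathrm{Iso}(D,D)$, and $(f^*\pi)_{i}(a\mid\tau)=\pi_{f^{-1}i}(f^{-1}a\mid f^{-1}\tau)$. For a profile $\mathbf g\in\mathrm{Aut}(D)^{\mathcal N}$ put $(\mathbf g^*\pi)_i=(\mathbf g_i^*\pi)_i$. The other-play objective is $J^D_{\mathrm{OP}}(\pi)=\mathbb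 E_{\mathbf g\sim\mathcal U(\mathrm{Aut}(D)^{\mathcal N})}[J^D(\mathbf g^*\pi)]$, and $\Pi^D_{\mathrm{OP}}=\arg\max J^D_{\mathrm{OP}}$. Let $\mu_i$ be the law of $(\mathbf g^*\pi)_i$ for $\mathbf g\sim\mathcal U(\mathrm{Aut}(D)^{\mathcal N})$. The symmetrizer $\Psi^D:\Pi^D\to\Pi^D$ is given by $$\Psi^D(\pi)_i(a\mid\tau)=\mathbb P_{\mu_i\otimes\mu_{-i}}(A_{i,t}=a\mid AO_{i,t}=\tau),$$ where $\mu_{-i}$ is any distribution of the other agents' policies with independent local policies such that $AO_{i,t}=\tau$ has positive probability when the policies are drawn from $\mu_i\otimes\mu_{-i}$ and then followed (if there is none, the value is $1/|\mathcal A_i|$). Write $\pi\equiv\pi'$ if $\Psi^D(\pi)=\Psi^D(\pi')$, $[\pi]$ for the class of $\pi$, and $f^*[\pi]=[f^*\pi]$. A labeling $f\in\mathrm{Sym}(D)$ is a tuple of bijections $f_N:\mathcal N\to\mathcal N$, $f_S:\mathcal S\to\{0,\dots,|\mathcal S|-1\}$, $f_{A_i}:\mathcal A_i\to\{0,\dots,|\mathcal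 A_i|-1\}$, $f_{O_i}:\mathcal O_i\to\{0,\dots,|\mathcal O_i|-1\}$; $f^*D$ is the Dec-POMDP on these label sets (agent $j$ having those of $f_N^{-1}j$) to which $f$ transports the data of $D$, so that $f\in\mathrm{Iso}(D,f^*D)$. The normal form $\iota(\tau)$ of $\tau\in\mathcal H^D$ numbers the states, and for each agent its actions and its observations, by $0,1,2,\dots$ in the order of first occurrence in $\tau$. $\mathcal K(\tau)\subseteq\mathrm{Sym}(D)$ is the set of labelings $f$ such that $f\tau$ is in normal form, i.e. $f\tau=f_N(\iota(\tau))$, where $f_N$ permutes the agents. Let $\mathcal D$ be a set of Dec-POMDPs and let $\#(L,\tau)$, for $L=f^*D$, $D\in\mathcal D$, $f\in\mathrm{Sym}(D)$, $\tau\in\mathcal H^{L}$, be i.i.d. real random variables on a probability space $(\Omega_\#,\mathbb P_\#)$ with $\mathbb P_\#(\#(L,\tau)=\lambda)=0$ for all $\lambda\in\mathbb R$. Define $$\chi^\#(D,\pi)=\mathbb E_{\tau\sim\mathbb P_{\Psi^D(\pi)}(H\in\cdot)}\Big[\mathbb E_{f\sim\mathcal U(\mathcal K(\tau))}\big[\#(f^*D,f\tau)\big]\Big]\qquad(D\in\mathcal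 D,\ \pi\in\Pi^D).$$ A real function $\chi$ of pairs $(D,\pi)$ is a *tie-breaking function* for a set $\mathcal C$ of Dec-POMDPs if for every $D\in\mathcal C$ it attains a maximum on $\{(D,\pi):\pi\in\Pi^D_{\mathrm{OP}}\}$, and $\chi(D,\pi)=\chi(D,\pi')$ implies $\pi\equiv\pi'$ for all $\pi,\pi'\in\Pi^D_{\mathrm{OP}}$. It is *invariant to isomorphism* on $\mathcal C$ if $\chi(D,\pi)=\chi(E,\pi')$ whenever $D,E\in\mathcal C$, $f\in\mathrm{Iso}(D,E)$, $\pi\in\Pi^D$, $\pi'\in\Pi^E$ and $f^*[\pi]=[\pi']$. **Theorem.** 1. For every realization $\omega\in\Omega_\#$, $\chi^\#$ is invariant to isomorphism on $\mathcal D$; and if all hash values at $\omega$ lie in $[0,1]$, then so do all values of $\chi^\#$. 2. Assume that for every $D\in\mathcal D$ and $\pi,\pi'\in\Pi^D$, if $\mathbb P_{\Psi^D(\pi)}(H=\tau)=\mathbb P_{\Psi^D(\pi')}(H=\tau)$ for all $\tau\in\mathcal H^D$, then $\Psi^D(\pi)=\Psi^D(\pi')$. Then for every $D\in\mathcal D$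 and all $\pi,\pi'\in\Pi^D$ with $\pi\not\equiv\pi'$, $\mathbb P_\#$-almost surely $\chi^\#(D,\pi)\ne\chi^\#(D,\pi')$. 3. Assume in addition that $\Pi^D_{\mathrm{OP}}/{\equiv}$ is finite for every $D\in\mathcal D$. Then for every countable $\mathcal C\subseteq\mathcal D$ (in particular for $\mathcal C=\mathcal D$ if $\mathcal D$ is countable), $\chi^\#$ is $\mathbb P_\#$-almost surely a tie-breaking function for $\mathcal C$. -/

import Mathlib

noncomputable section

namespace LFC

open MeasureTheory ProbabilityTheory
open scoped ENNReal BigOperators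

/-- The finite sets underlying a Dec-POMDP: agents `{0, …, N - 1}`, states, and for every agent its
individual actions and observations. -/
structure Frame where
  N : ℕ
  N_pos : 0 < N
  S : Type
  A : Fin N → Type
  Ob : Fin N → Type
  finS : Finite S
  finA : ∀ i, Finite (A i)
  finOb : ∀ i, Finite (Ob i)
  neA : ∀ i, Nonempty (A i)

attribute [instance] Frame.finS Frame.finA Frame.finOb Frame.neA

/-- Joint actions. -/
abbrev Frame.JointA (X : Frame) : Type := ∀ i, X.A i

/-- Joint observations. -/
abbrev Frame.JointO (X : Frame) : Type := ∀ i, X.Ob i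

/-- A finite-horizon Dec-POMDP. -/
structure DecPOMDP extends Frame where
  /-- transition kernel -/
  P : S → toFrame.JointA → PMF S
  /-- reward function -/
  R : S → toFrame.JointA → ℝ
  /-- observation kernel -/
  O : S → toFrame.JointA → PMF toFrame.JointO
  /-- initial state distribution -/
  b₀ : PMF S
  /-- horizon -/
  T : ℕ

/-- A tuple of bijections `(f_N, f_S, (f_{A_i})_i, (f_{O_i})_i)` with `f_{A_i} : A_i → A'_{f_N i}` and
`f_{O_i} : O_i → O'_{f_N i}`. The bijection of agent `i` is stored under the index `j = f_N i`, that is,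
`A j` is `f_{A_{f_N⁻¹ j}}` and `Ob j` is `f_{O_{f_N⁻¹ j}}`. -/
structure Bij (X Y : Frame) where
  N : Fin X.N ≃ Fin Y.N
  S : X.S ≃ Y.S
  A : ∀ j, X.A (N.symm j) ≃ Y.A j
  Ob : ∀ j, X.Ob (N.symm j) ≃ Y.Ob j

namespace Bij

variable {X Y : Frame}

/-- Action on joint actions: `(f a)_j = f_{A_{f_N⁻¹ j}} (a_{f_N⁻¹ j})`. -/
def onA (f : Bij X Y) : X.JointA ≃ Y.JointA :=
  (Equiv.piCongrLeft' X.A f.N).trans (Equiv.piCongrRight f.A)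

/-- Action on joint observations: `(f o)_j = f_{O_{f_N⁻¹ j}} (o_{f_N⁻¹ j})`. -/
def onO (f : Bij X Y) : X.JointO ≃ Y.JointO :=
  (Equiv.piCongrLeft' X.Ob f.N).trans (Equiv.piCongrRight f.Ob)

instance : Finite (Bij X Y) := by
  let φ : Bij X Y → Σ n : Fin X.N ≃ Fin Y.N,
      (X.S ≃ Y.S) × (∀ j, X.A (n.symm j) ≃ Y.A j) × (∀ j, X.Ob (n.symm j) ≃ Y.Ob j) :=
    fun f => ⟨f.N, f.S, f.A, f.Ob⟩
  refine Finite.of_injective φ ?_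
  rintro ⟨n, s, a, o⟩ ⟨n', s', a', o'⟩ h
  simp only [φ, Sigma.mk.injEq] at h
  obtain ⟨rfl, h⟩ := h
  simpa using h

end Bij

/-- Dec-POMDP isomorphisms, the set `Iso(D, E)`. -/
structure Iso (D E : DecPOMDP) extends Bij D.toFrame E.toFrame where
  horizon : D.T = E.T
  trans : ∀ s a s', D.P s a s' = E.P (S s) (toBij.onA a) (S s')
  obser : ∀ s a o, D.O s a o = E.O (S s) (toBij.onA a) (toBij.onO o)
  reward : ∀ s a, D.R s a = E.R (S s) (toBij.onA a)
  init : ∀ s, D.b₀ s = E.b₀ (S s)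

namespace Iso

variable {D E : DecPOMDP}

lemma toBij_injective : Function.Injective (Iso.toBij (D := D) (E := E)) := by
  rintro ⟨f, _⟩ ⟨g, _⟩ h
  cases h
  rfl

instance : Finite (Iso D E) := Finite.of_injective _ toBij_injective

instance : Fintype (Iso D E) := Fintype.ofFinite _

/-- The identity automorphism. -/
def refl (D : DecPOMDP) : Iso D D where
  N := Equiv.refl _
  S := Equiv.refl _
  A _ := Equiv.refl _
  Ob _ := Equiv.refl _
  horizon := rfl
  trans _ _ _ := rfl
  obser _ _ _ := rfl
  reward _ _ := rfl
  init _ := rfl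

end Iso

/-- Automorphisms. -/
abbrev Aut (D : DecPOMDP) : Type := Iso D D

instance (D : DecPOMDP) : Nonempty (Aut D) := ⟨Iso.refl D⟩

/-! ### Histories, policies and the induced process -/

/-- Histories of length `t`: states, joint actions and rewards at the times `0, …, t` and joint
observations at the times `1, …, t` (`obs s` is the observation at time `s + 1`). -/
structure History (D : DecPOMDP) (t : ℕ) where
  state : Fin (t + 1) → D.S
  act : Fin (t + 1) → D.JointA
  rew : Fin (t + 1) → Set.range (fun p : D.S × D.JointA => D.R p.1 p.2)
  obs : Fin t → D.JointO

/-- Complete histories, `ℋ^D`. -/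
abbrev Episode (D : DecPOMDP) : Type := History D D.T

namespace History

variable {D E : DecPOMDP} {t : ℕ}

instance : Finite (History D t) := by
  let φ : History D t → (Fin (t + 1) → D.S) × (Fin (t + 1) → D.JointA) ×
      (Fin (t + 1) → Set.range (fun p : D.S × D.JointA => D.R p.1 p.2)) × (Fin t → D.JointO) :=
    fun h => (h.state, h.act, h.rew, h.obs)
  refine Finite.of_injective φ ?_
  rintro ⟨s, a, r, o⟩ ⟨s', a', r', o'⟩ h
  simpa [φ] using h

instance : Fintype (History D t) := Fintype.ofFinite _

/-- The action-observation history `(a_{i,0}, o_{i,1}, …, a_{i,s-1}, o_{i,s})` of agent `i` at time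
`s ≤ t`. -/
def ao (h : History D t) (i : Fin D.N) (s : ℕ) (hs : s ≤ t) : Fin s → D.A i × D.Ob i :=
  fun r => (h.act ⟨r, by omega⟩ i, h.obs ⟨r, by omega⟩ i)

/-- The element-wise action of an isomorphism on histories; rewards are left unchanged. -/
def map (f : Iso D E) (h : History D t) : History E t where
  state s := f.S (h.state s)
  act s := f.onA (h.act s)
  rew s := ⟨(h.rew s : ℝ), by
    obtain ⟨p, hp⟩ := (h.rew s).2
    exact ⟨(f.S p.1, f.onA p.2), (f.reward p.1 p.2).symm.trans hp⟩⟩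
  obs s := f.onO (h.obs s)

end History

/-- Local stochastic policies of agent `i`: a distribution over actions for every action-observation
history of length `t ≤ T`. -/
def LocalPolicy (D : DecPOMDP) (i : Fin D.N) : Type :=
  ∀ t : ℕ, t ≤ D.T → (Fin t → D.A i × D.Ob i) → PMF (D.A i)

/-- Joint stochastic policies, `Π^D`. -/
abbrev Policy (D : DecPOMDP) : Type := ∀ i, LocalPolicy D i

/-- The σ-algebra on local policies generated by the probabilities `π_i(a ∣ τ)`. -/
instance (D : DecPOMDP) (i : Fin D.N) : MeasurableSpace (LocalPolicy D i) :=
  ⨆ (t : ℕ) (ht : t ≤ D.T) (τ : Fin t → D.A i × D.Ob i) (a : D.A i),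
    MeasurableSpace.comap (fun p : LocalPolicy D i => p t ht τ a) (borel ℝ≥0∞)

/-- The pushforward `(f^*π)_j(a ∣ τ) = π_{f⁻¹ j}(f⁻¹ a ∣ f⁻¹ τ)` of a policy by an isomorphism. -/
def pushPolicy {D E : DecPOMDP} (f : Iso D E) (π : Policy D) : Policy E :=
  fun j t ht τ =>
    (π (f.N.symm j) t (ht.trans_eq f.horizon.symm)
      (fun s => ((f.A j).symm (τ s).1, (f.Ob j).symm (τ s).2))).map (f.A j)

/-- `g^*π` for a profile `g` of automorphisms: agent `i` follows `proj_i (g_i^*π)`. -/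
def pushProfile {D : DecPOMDP} (g : Fin D.N → Aut D) (π : Policy D) : Policy D :=
  fun i => pushPolicy (g i) π i

open Classical in
/-- `ℙ_π(H_t = h)`, the probability of a history of length `t` when the agents follow `π`. -/
def prob {D : DecPOMDP} (π : Policy D) {t : ℕ} (ht : t ≤ D.T) (h : History D t) : ℝ≥0∞ :=
  D.b₀ (h.state 0) *
  (∏ s : Fin t, D.P (h.state s.castSucc) (h.act s.castSucc) (h.state s.succ) *
    D.O (h.state s.succ) (h.act s.castSucc) (h.obs s)) *
  (∏ s : Fin (t + 1),
    (∏ i, π i s (by omega) (h.ao i s (by omega)) (h.act s i)) *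
    (if (h.rew s : ℝ) = D.R (h.state s) (h.act s) then 1 else 0))

/-- Expected return `J^D(π)`. -/
def selfPlay {D : DecPOMDP} (π : Policy D) : ℝ :=
  ∑ h : Episode D, (prob π le_rfl h).toReal * ∑ s, (h.rew s : ℝ)

/-- The other-play objective: the mean of `J^D(g^*π)` over uniformly random profiles of automorphisms. -/
def otherPlay {D : DecPOMDP} (π : Policy D) : ℝ :=
  Finset.expect Finset.univ (fun g : Fin D.N → Aut D => selfPlay (pushProfile g π))

/-- The set `Π_OP^D` of maximizers of the other-play objective. -/
def opOptimal (D : DecPOMDP) : Set (Policy D) :=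
  {π | ∀ π' : Policy D, otherPlay π' ≤ otherPlay π}

/-! ### Policies corresponding to distributions over policies, and the symmetrizer -/

open Classical in
/-- `ℙ_μ(H_t ∈ Q)` when first a joint policy is drawn from `μ` and then followed. -/
def mixProb {D : DecPOMDP} (μ : Measure (Policy D)) {t : ℕ} (ht : t ≤ D.T)
    (Q : Set (History D t)) : ℝ≥0∞ :=
  ∑ h : History D t, if h ∈ Q then ∫⁻ π, prob π ht h ∂μ else 0

/-- The event `AO_{i,t} = τ`. -/
def aoEvent {D : DecPOMDP} (i : Fin D.N) (t : ℕ) (τ : Fin t → D.A i × D.Ob i) : Set (History D t) :=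
  {h | h.ao i t le_rfl = τ}

/-- The event `A_{i,t} = a`. -/
def actEvent {D : DecPOMDP} (i : Fin D.N) (t : ℕ) (a : D.A i) : Set (History D t) :=
  {h | h.act (Fin.last t) i = a}

/-- The distribution `μ_i ⊗ μ_{-i}` with independent local policies (`ν i` is ignored). -/
def withOpponents {D : DecPOMDP} (i : Fin D.N) (μi : ProbabilityMeasure (LocalPolicy D i))
    (ν : ∀ j, ProbabilityMeasure (LocalPolicy D j)) : Measure (Policy D) :=
  Measure.pi (fun j => (Function.update ν i μi j : Measure (LocalPolicy D j)))

lemma prob_le_one {D : DecPOMDP} (π : Policy D) {t : ℕ} (ht : t ≤ D.T) (h : History D t) :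
    prob π ht h ≤ 1 := by
  unfold prob
  refine mul_le_one' (mul_le_one' (PMF.coe_le_one _ _) (Finset.prod_le_one' fun s _ =>
    mul_le_one' (PMF.coe_le_one _ _) (PMF.coe_le_one _ _))) (Finset.prod_le_one' fun s _ =>
    mul_le_one' (Finset.prod_le_one' fun i _ => PMF.coe_le_one _ _) ?_)
  split_ifs <;> simp

lemma mixProb_ne_top {D : DecPOMDP} (μ : Measure (Policy D)) [IsProbabilityMeasure μ] {t : ℕ}
    (ht : t ≤ D.T) (Q : Set (History D t)) : mixProb μ ht Q ≠ ⊤ := by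
  unfold mixProb
  refine ENNReal.sum_ne_top.2 fun h _ => ?_
  split_ifs
  · refine ne_top_of_le_ne_top ENNReal.one_ne_top ?_
    calc ∫⁻ π, prob π ht h ∂μ ≤ ∫⁻ _, 1 ∂μ := lintegral_mono fun π => prob_le_one π ht h
      _ = 1 := by simp
  · simp

instance {D : DecPOMDP} (i : Fin D.N) (μi : ProbabilityMeasure (LocalPolicy D i))
    (ν : ∀ j, ProbabilityMeasure (LocalPolicy D j)) : IsProbabilityMeasure (withOpponents i μi ν) := by
  unfold withOpponents
  infer_instance

lemma tsum_mixProb {D : DecPOMDP} (μ : Measure (Policy D)) (i : Fin D.N) {t : ℕ} (ht : t ≤ D.T)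
    (τ : Fin t → D.A i × D.Ob i) :
    ∑' a, mixProb μ ht (actEvent i t a ∩ aoEvent i t τ) = mixProb μ ht (aoEvent i t τ) := by
  classical
  let _ := Fintype.ofFinite (D.A i)
  rw [tsum_fintype]
  unfold mixProb
  rw [Finset.sum_comm]
  refine Finset.sum_congr rfl fun h _ => ?_
  by_cases hh : h ∈ aoEvent i t τ
  · rw [Finset.sum_eq_single (h.act (Fin.last t) i)]
    · simp [hh, actEvent]
    · intro b _ hb
      simp [actEvent, hb.symm]
    · simp
  · simp [hh]

/-- `ℙ_μ(A_{i,t} = · ∣ AO_{i,t} = τ)`, if the condition has positive probability. -/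
def condAction {D : DecPOMDP} (μ : Measure (Policy D)) [IsProbabilityMeasure μ] (i : Fin D.N) {t : ℕ}
    (ht : t ≤ D.T) (τ : Fin t → D.A i × D.Ob i) (h : mixProb μ ht (aoEvent i t τ) ≠ 0) :
    PMF (D.A i) :=
  ⟨fun a => mixProb μ ht (actEvent i t a ∩ aoEvent i t τ) / mixProb μ ht (aoEvent i t τ), by
    rw [ENNReal.summable.hasSum_iff]
    simp only [div_eq_mul_inv]
    rw [ENNReal.tsum_mul_right, tsum_mixProb]
    exact ENNReal.mul_inv_cancel h (mixProb_ne_top _ _ _)⟩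

open Classical in
/-- The local policy `π_i^{μ_i}` corresponding to a distribution `μ_i` over local policies of agent `i`:
the conditional distribution of the action given the action-observation history, with the opponents
following any distribution (with independent local policies) under which that history has positive
probability, and uniform if there is none. -/
def mixtureLocal {D : DecPOMDP} (i : Fin D.N) (μi : ProbabilityMeasure (LocalPolicy D i)) :
    LocalPolicy D i :=
  fun t ht τ =>
    if h : ∃ ν : ∀ j, ProbabilityMeasure (LocalPolicy D j),
        mixProb (withOpponents i μi ν) ht (aoEvent i t τ) ≠ 0 then
      condAction (withOpponents i μi h.choose) i ht τ h.choose_spec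
    else
      letI := Fintype.ofFinite (D.A i)
      PMF.uniformOfFintype (D.A i)

/-- The other-play distribution of `π`, i.e. the law of `g^*π` for a uniformly random profile `g` of
automorphisms. -/
def opDist {D : DecPOMDP} (π : Policy D) : PMF (Policy D) :=
  (PMF.uniformOfFintype (Fin D.N → Aut D)).map (fun g => pushProfile g π)

/-- The marginal of the other-play distribution for agent `i`. -/
def opMarginal {D : DecPOMDP} (π : Policy D) (i : Fin D.N) : ProbabilityMeasure (LocalPolicy D i) :=
  ⟨((opDist π).map (fun σ => σ i)).toMeasure, inferInstance⟩

/-- The symmetrizer `Ψ^D`. -/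
def symmetrizer {D : DecPOMDP} (π : Policy D) : Policy D :=
  fun i => mixtureLocal i (opMarginal π i)

/-- The equivalence `π ≡_D π'`, i.e. `Ψ^D(π) = Ψ^D(π')`. -/
def policySetoid (D : DecPOMDP) : Setoid (Policy D) := Setoid.ker symmetrizer

/-! ### Labelings and relabeled Dec-POMDPs -/

/-- Labelings of a Dec-POMDP, the set `Sym(D)`; the labels are `{0, …, k - 1}`. -/
structure Labeling (X : Frame) where
  N : Fin X.N ≃ Fin X.N
  S : X.S ≃ Fin (Nat.card X.S)
  A : ∀ i, X.A i ≃ Fin (Nat.card (X.A i))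
  Ob : ∀ i, X.Ob i ≃ Fin (Nat.card (X.Ob i))

namespace Labeling

instance (X : Frame) : Finite (Labeling X) := by
  let φ : Labeling X → (Fin X.N ≃ Fin X.N) × (X.S ≃ Fin (Nat.card X.S)) ×
      (∀ i, X.A i ≃ Fin (Nat.card (X.A i))) × (∀ i, X.Ob i ≃ Fin (Nat.card (X.Ob i))) :=
    fun f => (f.N, f.S, f.A, f.Ob)
  refine Finite.of_injective φ ?_
  rintro ⟨n, s, a, o⟩ ⟨n', s', a', o'⟩ h
  simpa [φ] using h

instance (X : Frame) : Fintype (Labeling X) := Fintype.ofFinite _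

/-- The sets underlying a relabeled Dec-POMDP. -/
def frame {X : Frame} (f : Labeling X) : Frame where
  N := X.N
  N_pos := X.N_pos
  S := Fin (Nat.card X.S)
  A j := Fin (Nat.card (X.A (f.N.symm j)))
  Ob j := Fin (Nat.card (X.Ob (f.N.symm j)))
  finS := inferInstance
  finA _ := inferInstance
  finOb _ := inferInstance
  neA j := ⟨f.A (f.N.symm j) (Classical.arbitrary _)⟩

/-- A labeling as a tuple of bijections onto the relabeled sets. -/
def toBij {X : Frame} (f : Labeling X) : Bij X f.frame where
  N := f.N
  S := f.S
  A j := f.A (f.N.symm j)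
  Ob j := f.Ob (f.N.symm j)

/-- The relabeled Dec-POMDP `f^*D`. -/
def relabel (D : DecPOMDP) (f : Labeling D.toFrame) : DecPOMDP where
  toFrame := f.frame
  P s a := (D.P (f.toBij.S.symm s) (f.toBij.onA.symm a)).map f.toBij.S
  R s a := D.R (f.toBij.S.symm s) (f.toBij.onA.symm a)
  O s a := (D.O (f.toBij.S.symm s) (f.toBij.onA.symm a)).map f.toBij.onO
  b₀ := D.b₀.map f.toBij.S
  T := D.T

lemma map_equiv_apply {α β : Type} (p : PMF α) (e : α ≃ β) (x : α) : p.map e (e x) = p x := by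
  classical
  rw [PMF.map_apply, tsum_eq_single x]
  · simp
  · intro y hy
    simp [hy.symm]

/-- A labeling is an isomorphism from `D` to `f^*D`. -/
def toIso (D : DecPOMDP) (f : Labeling D.toFrame) : Iso D (relabel D f) where
  toBij := f.toBij
  horizon := rfl
  trans s a s' := by
    change _ = (D.P (f.toBij.S.symm (f.toBij.S s)) (f.toBij.onA.symm (f.toBij.onA a))).map
      f.toBij.S (f.toBij.S s')
    rw [map_equiv_apply, f.toBij.S.symm_apply_apply, f.toBij.onA.symm_apply_apply]
  obser s a o := by
    change _ = (D.O (f.toBij.S.symm (f.toBij.S s)) (f.toBij.onA.symm (f.toBij.onA a))).map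
      f.toBij.onO (f.toBij.onO o)
    rw [map_equiv_apply, f.toBij.S.symm_apply_apply, f.toBij.onA.symm_apply_apply]
  reward s a := by
    change _ = D.R (f.toBij.S.symm (f.toBij.S s)) (f.toBij.onA.symm (f.toBij.onA a))
    rw [f.toBij.S.symm_apply_apply, f.toBij.onA.symm_apply_apply]
  init s := (map_equiv_apply _ f.toBij.S s).symm

/-- The history `f τ` of the relabeled Dec-POMDP. -/
def onEpisode {D : DecPOMDP} (f : Labeling D.toFrame) (τ : Episode D) : Episode (relabel D f) :=
  History.map (f.toIso D) τ

end Labeling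

/-! ### Normal forms, hashes and tie-breaking functions -/

/-- Histories whose states, actions and observations are natural numbers. -/
structure NumHistory (N t : ℕ) where
  state : Fin (t + 1) → ℕ
  act : Fin (t + 1) → Fin N → ℕ
  rew : Fin (t + 1) → ℝ
  obs : Fin t → Fin N → ℕ

/-- The permutation of the agents in a numbered history. -/
def NumHistory.permute {N t : ℕ} (e : Fin N ≃ Fin N) (h : NumHistory N t) : NumHistory N t where
  state := h.state
  act s j := h.act s (e.symm j)
  rew := h.rew
  obs s j := h.obs s (e.symm j)

/-- Numbering by order of first occurrence: the number of `x t` counts the distinct values that occur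
before the first occurrence of `x t` in the sequence `x`. -/
def firstOccurrence {n : ℕ} {α : Type} (x : Fin n → α) (t : Fin n) : ℕ :=
  (x '' {s | ∀ r ≤ s, x r ≠ x t}).ncard

/-- The normal form `ι(τ)`: states, and for each agent its actions and its observations, are numbered
by order of first occurrence. -/
def normalForm {D : DecPOMDP} {t : ℕ} (τ : History D t) : NumHistory D.N t where
  state := firstOccurrence τ.state
  act s i := firstOccurrence (fun r => τ.act r i) s
  rew s := τ.rew s
  obs s i := firstOccurrence (fun r => τ.obs r i) s

/-- The history `f τ` of a relabeled Dec-POMDP with its labels read as natural numbers. -/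
def Labeling.numbers {D : DecPOMDP} (f : Labeling D.toFrame) (τ : Episode D) :
    NumHistory D.N D.T where
  state s := Fin.val (n := Nat.card D.S) ((f.onEpisode τ).state s)
  act s j := Fin.val (n := Nat.card (D.A (f.N.symm j))) ((f.onEpisode τ).act s j)
  rew s := (f.onEpisode τ).rew s
  obs s j := Fin.val (n := Nat.card (D.Ob (f.N.symm j))) ((f.onEpisode τ).obs s j)

open Classical in
/-- The set `𝒦(τ)` of labelings `f` for which `f τ` is the normal form of `τ`; since `f` also permutes the
agents, this normal form is `f_N(ι(τ))`. -/
def normalLabelings {D : DecPOMDP} (τ : Episode D) : Finset (Labeling D.toFrame) :=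
  Finset.univ.filter fun f => f.numbers τ = (normalForm τ).permute f.N

/-- The arguments of hash functions: a Dec-POMDP with one of its histories. -/
abbrev HashArg : Type 1 := Σ L : DecPOMDP, Episode L

/-- The arguments `(f^*D, τ)` with `D ∈ 𝒟`, `f ∈ Sym(D)` and `τ ∈ ℋ^{f^*D}`. -/
def hashArgs (𝒟 : Set DecPOMDP) : Set HashArg :=
  {x | ∃ D ∈ 𝒟, ∃ f : Labeling D.toFrame, x.1 = f.relabel D}

/-- Random hash functions for `𝒟`: the values at the arguments `(f^*D, τ)` are i.i.d. real random
variables without atoms. -/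
structure IsRandomHash (𝒟 : Set DecPOMDP) {Ω : Type*} [MeasurableSpace Ω] (μ : Measure Ω)
    (hash : HashArg → Ω → ℝ) : Prop where
  measurable : ∀ x ∈ hashArgs 𝒟, Measurable (hash x)
  indep : iIndepFun (fun x : hashArgs 𝒟 => hash x) μ
  identDistrib : ∀ x ∈ hashArgs 𝒟, ∀ y ∈ hashArgs 𝒟, IdentDistrib (hash x) (hash y) μ μ
  noAtoms : ∀ x ∈ hashArgs 𝒟, ∀ c : ℝ, μ {ω | hash x ω = c} = 0

/-- `χ^#(D, π)` for a realization `η` of the hash function: the expectation, over the history `τ` under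
`Ψ^D(π)`, of the mean of `η(f^*D, f τ)` over uniformly random `f ∈ 𝒦(τ)`. -/
def chi (η : HashArg → ℝ) (D : DecPOMDP) (π : Policy D) : ℝ :=
  ∑ τ : Episode D, (prob (symmetrizer π) le_rfl τ).toReal *
    Finset.expect (normalLabelings τ) (fun f => η ⟨f.relabel D, f.onEpisode τ⟩)

/-- Tie-breaking functions for `𝒟`: `χ(D, ·)` attains a maximum on the set of OP-optimal policies, and
separates OP-optimal policies that are not equivalent. -/
def IsTieBreaking (𝒟 : Set DecPOMDP) (χ : ∀ D : DecPOMDP, Policy D → ℝ) : Prop :=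
  ∀ D ∈ 𝒟,
    (∃ π ∈ opOptimal D, ∀ π' ∈ opOptimal D, χ D π' ≤ χ D π) ∧
    (∀ π ∈ opOptimal D, ∀ π' ∈ opOptimal D, χ D π = χ D π' → policySetoid D π π')

/-- Invariance to isomorphism: `f^*[π] = [π']` implies `χ(D, π) = χ(E, π')`, where `f^*[π] = [f^*π]`. -/
def IsIsoInvariant (𝒟 : Set DecPOMDP) (χ : ∀ D : DecPOMDP, Policy D → ℝ) : Prop :=
  ∀ D ∈ 𝒟, ∀ E ∈ 𝒟, ∀ (f : Iso D E) (π : Policy D) (π' : Policy E),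
    Quotient.mk (policySetoid E) (pushPolicy f π) = Quotient.mk (policySetoid E) π' →
      χ D π = χ E π'

/-- The set of equivalence classes of OP-optimal policies, `Π_OP^D / ≡`, is finite. -/
def FiniteOPClasses (D : DecPOMDP) : Prop :=
  Finite (Quotient ((policySetoid D).comap ((↑) : opOptimal D → Policy D)))

/-- Symmetrized policies that induce the same distribution over histories are equal. -/
def HistoriesDetermine (D : DecPOMDP) : Prop :=
  ∀ π π' : Policy D,
    (∀ τ : Episode D, prob (symmetrizer π) le_rfl τ = prob (symmetrizer π') le_rfl τ) →
      symmetrizer π = symmetrizer π'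

end LFC

end

noncomputable section

namespace LFC

open MeasureTheory ProbabilityTheory
open scoped ENNReal BigOperators

section

/-! ### Groupoid structure of isomorphisms -/

namespace Bij

variable {X Y Z : Frame}

/-! Invariance. An isomorphism `f` from `D` to `E` transports everything that enters `chi`. The
symmetrizer commutes with it (`symmetrizer_pushPolicy`), and so do history probabilities
(`prob_onEpisode`). Composition with `f` is a bijection from the labelings of `E` that normalize `f
τ` onto those of `D` that normalize `τ`. The relabeled model and relabeled history obtained from `g`
and from `g ∘ f` are literally equal (`hashArg_pull`), so the same hash values are averaged.
Reindexing the sum over histories gives `chi_pushPolicy`. The symmetrizer is defined through an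
arbitrary choice of opponents, so it first needs a closed form (`mixtureLocal_apply`). The weight of
environment and opponents does not depend on the last action of agent `i`, hence it cancels in the
conditional probability. What remains is an average over automorphisms, and this average can be
reindexed by isomorphisms.

Range. The value of `chi` is a combination of means of hash values over nonempty sets of labelings,
with nonnegative weights of total mass at most 1.

Separation. For fixed policies the difference of the two values of `chi` is a linear combination of
hash variables. Distinct pairs (history, labeling) may lead to the same variable, so coefficients
could cancel. They do not: if two pairs collide, the two labelings differ by an automorphism
carrying one history to the other (`exists_aut_of_hashArg_eq`), and symmetrized history
probabilities and the number of normalizing labelings are invariant under automorphisms. So all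
contributions to one variable are equal, and a history whose two probabilities differ gives a
nonzero coefficient (`ae_chi_ne`). A nontrivial combination of independent atomless variables is
almost surely nonzero (`ae_sum_mul_ne_zero`).

Tie-breaking. Only finitely many classes per model and countably many models have to be separated,
so the null sets add up to a null set. The maximum is taken over a finite set of classes, nonempty
because other-play is continuous on a compact space of policies (`opOptimal_nonempty`). -/

/-- The bijection of individual actions of agent `i` onto those of agent `j = f_N i`. -/
def fA (f : Bij X Y) {i : Fin X.N} {j : Fin Y.N} (h : f.N.symm j = i) : X.A i ≃ Y.A j :=
  h ▸ f.A j

/-- The bijection of individual observations of agent `i` onto those of agent `j = f_N i`. -/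
def fO (f : Bij X Y) {i : Fin X.N} {j : Fin Y.N} (h : f.N.symm j = i) : X.Ob i ≃ Y.Ob j :=
  h ▸ f.Ob j

/-- The index `i` is free and tied to `j` only by the equation `h`. This lets identities between
dependent families be stated without casts and proved by `subst`. -/
lemma onA_apply (f : Bij X Y) (a : X.JointA) {i : Fin X.N} {j : Fin Y.N} (h : f.N.symm j = i) :
    f.onA a j = f.fA h (a i) := by
  subst h; rfl

lemma onO_apply (f : Bij X Y) (o : X.JointO) {i : Fin X.N} {j : Fin Y.N} (h : f.N.symm j = i) :
    f.onO o j = f.fO h (o i) := by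
  subst h; rfl

lemma ext_of_components {f g : Bij X Y} (hN : f.N = g.N) (hS : f.S = g.S)
    (hA : ∀ i j (h : f.N.symm j = i) (h' : g.N.symm j = i), f.fA h = g.fA h')
    (hO : ∀ i j (h : f.N.symm j = i) (h' : g.N.symm j = i), f.fO h = g.fO h') : f = g := by
  obtain ⟨n, s, a, o⟩ := f
  obtain ⟨n', s', a', o'⟩ := g
  dsimp only at hN hS
  subst hN hS
  obtain rfl : a = a' := funext fun j => hA _ j rfl rfl
  obtain rfl : o = o' := funext fun j => hO _ j rfl rfl
  rfl

/-- Composition. -/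
def comp (f : Bij X Y) (g : Bij Y Z) : Bij X Z where
  N := f.N.trans g.N
  S := f.S.trans g.S
  A j := (f.A (g.N.symm j)).trans (g.A j)
  Ob j := (f.Ob (g.N.symm j)).trans (g.Ob j)

/-- Inverse. -/
def inv (f : Bij X Y) : Bij Y X where
  N := f.N.symm
  S := f.S.symm
  A j := (f.fA (f.N.symm_apply_apply j)).symm
  Ob j := (f.fO (f.N.symm_apply_apply j)).symm

lemma comp_fA (f : Bij X Y) (g : Bij Y Z) {i : Fin X.N} {j : Fin Y.N} {k : Fin Z.N}
    (h : f.N.symm j = i) (h' : g.N.symm k = j) (h'' : (f.comp g).N.symm k = i) :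
    (f.comp g).fA h'' = (f.fA h).trans (g.fA h') := by
  subst h'; subst h; rfl

lemma comp_fO (f : Bij X Y) (g : Bij Y Z) {i : Fin X.N} {j : Fin Y.N} {k : Fin Z.N}
    (h : f.N.symm j = i) (h' : g.N.symm k = j) (h'' : (f.comp g).N.symm k = i) :
    (f.comp g).fO h'' = (f.fO h).trans (g.fO h') := by
  subst h'; subst h; rfl

lemma inv_fA (f : Bij X Y) {i : Fin X.N} {j : Fin Y.N} (h : f.N.symm j = i)
    (h' : f.inv.N.symm i = j) : f.inv.fA h' = (f.fA h).symm := by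
  subst h'; rfl

lemma inv_fO (f : Bij X Y) {i : Fin X.N} {j : Fin Y.N} (h : f.N.symm j = i)
    (h' : f.inv.N.symm i = j) : f.inv.fO h' = (f.fO h).symm := by
  subst h'; rfl

lemma inv_N_symm (f : Bij X Y) {i : Fin X.N} {j : Fin Y.N} (h : f.N.symm j = i) :
    f.inv.N.symm i = j := by
  subst h; exact f.N.apply_symm_apply j

lemma inv_onA_onA (f : Bij X Y) (a : X.JointA) : f.inv.onA (f.onA a) = a := by
  funext i
  have h : f.N.symm (f.N i) = i := f.N.symm_apply_apply i
  rw [onA_apply f.inv _ (f.inv_N_symm h), onA_apply f _ h, inv_fA f h, Equiv.symm_apply_apply]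

lemma inv_onO_onO (f : Bij X Y) (o : X.JointO) : f.inv.onO (f.onO o) = o := by
  funext i
  have h : f.N.symm (f.N i) = i := f.N.symm_apply_apply i
  rw [onO_apply f.inv _ (f.inv_N_symm h), onO_apply f _ h, inv_fO f h, Equiv.symm_apply_apply]

lemma inv_inv (f : Bij X Y) : f.inv.inv = f := by
  refine ext_of_components rfl rfl (fun i j h h' => ?_) (fun i j h h' => ?_)
  · rw [inv_fA f.inv (f.inv_N_symm h'), inv_fA f h', Equiv.symm_symm]
  · rw [inv_fO f.inv (f.inv_N_symm h'), inv_fO f h', Equiv.symm_symm]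

lemma onA_inv_onA (f : Bij X Y) (a : Y.JointA) : f.onA (f.inv.onA a) = a := by
  conv_lhs => enter [1]; rw [← inv_inv f]
  exact inv_onA_onA f.inv a

lemma onO_inv_onO (f : Bij X Y) (o : Y.JointO) : f.onO (f.inv.onO o) = o := by
  conv_lhs => enter [1]; rw [← inv_inv f]
  exact inv_onO_onO f.inv o

lemma comp_inv_cancel (f : Bij X Y) (g : Bij Y Z) : f.inv.comp (f.comp g) = g := by
  refine ext_of_components ?_ ?_ (fun j k h h' => ?_) (fun j k h h' => ?_)
  · ext; simp [comp, inv]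
  · ext; simp [comp, inv]
  · have h₁ : (f.comp g).N.symm k = f.N.symm j := by rw [← h']; rfl
    rw [comp_fA f.inv (f.comp g) (f.inv_N_symm rfl) h₁, comp_fA f g rfl h', inv_fA f rfl]
    ext; simp
  · have h₁ : (f.comp g).N.symm k = f.N.symm j := by rw [← h']; rfl
    rw [comp_fO f.inv (f.comp g) (f.inv_N_symm rfl) h₁, comp_fO f g rfl h', inv_fO f rfl]
    ext; simp

lemma inv_comp_cancel (f : Bij X Y) (g : Bij Y Z) : (f.comp g).comp g.inv = f := by
  refine ext_of_components ?_ ?_ (fun i j h h' => ?_) (fun i j h h' => ?_)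
  · ext; simp [comp, inv]
  · ext; simp [comp, inv]
  · have e : g.N.symm (g.N j) = j := g.N.symm_apply_apply j
    have h₁ : (f.comp g).N.symm (g.N j) = i := by rw [← h']; exact congrArg f.N.symm e
    rw [comp_fA (f.comp g) g.inv h₁ (g.inv_N_symm e), comp_fA f g h' e, inv_fA g e]
    ext; simp
  · have e : g.N.symm (g.N j) = j := g.N.symm_apply_apply j
    have h₁ : (f.comp g).N.symm (g.N j) = i := by rw [← h']; exact congrArg f.N.symm e
    rw [comp_fO (f.comp g) g.inv h₁ (g.inv_N_symm e), comp_fO f g h' e, inv_fO g e]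
    ext; simp

section Conj

variable {X' Y' : Frame} (k : Bij X X') (f : Bij X Y) (g : Bij Y Y') {i : Fin X.N} {i' : Fin X'.N}
  {j : Fin Y.N} {j' : Fin Y'.N} (hk : k.N.symm i' = i) (hf : f.N.symm j = i) (hg : g.N.symm j' = j)
  (h : (k.inv.comp (f.comp g)).N.symm j' = i')

/-- With labelings for `k` and `g`, the composite is the induced map between two relabeled models;
this commuting square computes it in `hashArg_pull`. -/
lemma conj_fA (a : X.A i) :
    (k.inv.comp (f.comp g)).fA h (k.fA hk a) = g.fA hg (f.fA hf a) := by
  have h' : (f.comp g).N.symm j' = i := by rw [← hf, ← hg]; rfl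
  rw [comp_fA k.inv (f.comp g) (k.inv_N_symm hk) h', comp_fA f g hf hg, inv_fA k hk]
  simp

lemma conj_fO (o : X.Ob i) :
    (k.inv.comp (f.comp g)).fO h (k.fO hk o) = g.fO hg (f.fO hf o) := by
  have h' : (f.comp g).N.symm j' = i := by rw [← hf, ← hg]; rfl
  rw [comp_fO k.inv (f.comp g) (k.inv_N_symm hk) h', comp_fO f g hf hg, inv_fO k hk]
  simp

end Conj

end Bij

namespace Iso

variable {D E F : DecPOMDP}

/-- Composition of isomorphisms. -/
def comp (f : Iso D E) (g : Iso E F) : Iso D F where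
  toBij := f.toBij.comp g.toBij
  horizon := f.horizon.trans g.horizon
  trans s a s' := (f.trans s a s').trans (g.trans _ _ _)
  obser s a o := (f.obser s a o).trans (g.obser _ _ _)
  reward s a := (f.reward s a).trans (g.reward _ _)
  init s := (f.init s).trans (g.init _)

/-- The inverse isomorphism. -/
def inv (f : Iso D E) : Iso E D where
  toBij := f.toBij.inv
  horizon := f.horizon.symm
  trans s a s' := by
    have := f.trans (f.S.symm s) (f.toBij.inv.onA a) (f.S.symm s')
    rw [Bij.onA_inv_onA, Equiv.apply_symm_apply, Equiv.apply_symm_apply] at this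
    exact this.symm
  obser s a o := by
    have := f.obser (f.S.symm s) (f.toBij.inv.onA a) (f.toBij.inv.onO o)
    rw [Bij.onA_inv_onA, Bij.onO_inv_onO, Equiv.apply_symm_apply] at this
    exact this.symm
  reward s a := by
    have := f.reward (f.S.symm s) (f.toBij.inv.onA a)
    rw [Bij.onA_inv_onA, Equiv.apply_symm_apply] at this
    exact this.symm
  init s := by
    have := f.init (f.S.symm s)
    rw [Equiv.apply_symm_apply] at this
    exact this.symm

lemma inv_inv (f : Iso D E) : f.inv.inv = f := toBij_injective f.toBij.inv_inv

lemma comp_inv_cancel (f : Iso D E) (g : Iso E F) : f.inv.comp (f.comp g) = g :=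
  toBij_injective (f.toBij.comp_inv_cancel g.toBij)

lemma inv_comp_cancel (f : Iso D E) (g : Iso E F) : (f.comp g).comp g.inv = f :=
  toBij_injective (f.toBij.inv_comp_cancel g.toBij)

/-- Precomposition with an isomorphism. -/
def compLeftEquiv (f : Iso D E) : Iso E F ≃ Iso D F where
  toFun g := f.comp g
  invFun h := f.inv.comp h
  left_inv g := comp_inv_cancel f g
  right_inv h := by
    have := comp_inv_cancel f.inv h
    rwa [inv_inv] at this

/-- Postcomposition with an isomorphism. -/
def compRightEquiv (g : Iso E F) : Iso D E ≃ Iso D F where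
  toFun f := f.comp g
  invFun h := h.comp g.inv
  left_inv f := inv_comp_cancel f g
  right_inv h := by
    have := inv_comp_cancel h g.inv
    rwa [inv_inv] at this

end Iso

/-! ### The action of isomorphisms on histories -/

namespace History

variable {D E : DecPOMDP} {t t' : ℕ}

@[ext]
lemma ext_of_apply {h h' : History D t} (hs : ∀ s, h.state s = h'.state s) (ha : ∀ s, h.act s = h'.act s)
    (hr : ∀ s, (h.rew s : ℝ) = h'.rew s) (ho : ∀ s, h.obs s = h'.obs s) : h = h' := by
  obtain ⟨a, b, c, d⟩ := h
  obtain ⟨a', b', c', d'⟩ := h'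
  obtain rfl : a = a' := funext hs
  obtain rfl : b = b' := funext ha
  obtain rfl : c = c' := funext fun s => Subtype.ext (hr s)
  obtain rfl : d = d' := funext ho
  rfl

lemma map_inv_map (f : Iso D E) (h : History D t) : map f.inv (map f h) = h := by
  ext1 s
  · exact f.S.symm_apply_apply _
  · exact f.toBij.inv_onA_onA _
  · rfl
  · exact f.toBij.inv_onO_onO _

lemma map_map_inv (f : Iso D E) (h : History E t) : map f (map f.inv h) = h := by
  have := map_inv_map f.inv h
  rwa [Iso.inv_inv] at this

/-- Histories along an equality of lengths. -/
def cast (e : t = t') (h : History D t) : History D t' where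
  state s := h.state (s.cast (by rw [e]))
  act s := h.act (s.cast (by rw [e]))
  rew s := h.rew (s.cast (by rw [e]))
  obs s := h.obs (s.cast e.symm)

lemma ao_map (f : Iso D E) (h : History D t) (j : Fin E.N) (s : ℕ) (hs : s ≤ t) :
    (map f h).ao j s hs = fun r => (f.A j (h.ao (f.N.symm j) s hs r).1,
      f.Ob j (h.ao (f.N.symm j) s hs r).2) := rfl

end History

namespace Iso

variable {D E F : DecPOMDP}

/-- The action of an isomorphism on complete histories. -/
def onEpisode (f : Iso D E) (τ : Episode D) : Episode E := (History.map f τ).cast f.horizon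

lemma onEpisode_comp (f : Iso D E) (g : Iso E F) (τ : Episode D) :
    (f.comp g).onEpisode τ = g.onEpisode (f.onEpisode τ) := rfl

/-- The action on complete histories as a bijection. -/
def episodeEquiv (f : Iso D E) : Episode D ≃ Episode E where
  toFun := f.onEpisode
  invFun := f.inv.onEpisode
  left_inv := History.map_inv_map f
  right_inv τ := History.map_map_inv f τ

end Iso

end

section

/-! ### Factorization of history probabilities -/

variable {D : DecPOMDP}

open Classical in
/-- The factor of `prob` that does not depend on the policies. -/
def envProb {t : ℕ} (h : History D t) : ℝ≥0∞ :=
  D.b₀ (h.state 0) *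
  (∏ s : Fin t, D.P (h.state s.castSucc) (h.act s.castSucc) (h.state s.succ) *
    D.O (h.state s.succ) (h.act s.castSucc) (h.obs s)) *
  ∏ s : Fin (t + 1), (if (h.rew s : ℝ) = D.R (h.state s) (h.act s) then 1 else 0)

/-- The factor of `prob` contributed by a local policy. -/
def pathWeight {i : Fin D.N} {t : ℕ} (ht : t ≤ D.T) (τ : Fin t → D.A i × D.Ob i) (a : D.A i)
    (p : LocalPolicy D i) : ℝ≥0∞ :=
  (∏ s : Fin t, p s (by omega) (fun r : Fin s => τ ⟨r, by omega⟩) (τ s).1) * p t ht τ a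

/-- Each local policy enters through a factor of its own, so integration against a product measure
splits agent by agent. -/
lemma prob_eq_envProb_mul (π : Policy D) {t : ℕ} (ht : t ≤ D.T) (h : History D t) :
    prob π ht h =
      envProb h * ∏ i, pathWeight ht (h.ao i t le_rfl) (h.act (Fin.last t) i) (π i) := by
  have key : (∏ s : Fin (t + 1), ∏ i, π i s (by omega) (h.ao i s (by omega)) (h.act s i)) =
      ∏ i, pathWeight ht (h.ao i t le_rfl) (h.act (Fin.last t) i) (π i) := by
    refine Finset.prod_comm.trans (Finset.prod_congr rfl fun i _ => ?_)
    -- The first `s` entries of `h.ao i t` are definitionally `h.ao i s`, so splitting off the last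
    -- time step is all that is needed.
    exact Fin.prod_univ_castSucc _
  rw [← key]
  unfold prob envProb
  refine Eq.trans ?_ (mul_assoc _ _ _).symm
  refine congrArg₂ _ rfl ?_
  rw [mul_comm]
  exact Finset.prod_mul_distrib

lemma measurable_localPolicy_apply {i : Fin D.N} {t : ℕ} (ht : t ≤ D.T)
    (τ : Fin t → D.A i × D.Ob i) (a : D.A i) :
    Measurable (fun p : LocalPolicy D i => p t ht τ a) := by
  refine measurable_iff_comap_le.2 (le_trans
    (MeasurableSpace.comap_mono (BorelSpace.measurable_eq (α := ℝ≥0∞)).le) ?_)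
  exact le_iSup_of_le t (le_iSup_of_le ht (le_iSup_of_le τ (le_iSup_of_le a le_rfl)))

lemma measurable_pathWeight {i : Fin D.N} {t : ℕ} (ht : t ≤ D.T) (τ : Fin t → D.A i × D.Ob i)
    (a : D.A i) : Measurable (pathWeight ht τ a) := by
  refine Measurable.mul (Finset.measurable_prod _ fun s _ => ?_) ?_
  · exact measurable_localPolicy_apply _ _ _
  · exact measurable_localPolicy_apply _ _ _

/-- Coordinates are independent under a product measure. -/
lemma lintegral_pi_prod {ι : Type} [Fintype ι] {X : ι → Type} [∀ i, MeasurableSpace (X i)]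
    (μ : ∀ i, Measure (X i)) [∀ i, IsProbabilityMeasure (μ i)] (w : ∀ i, X i → ℝ≥0∞)
    (hw : ∀ i, Measurable (w i)) :
    ∫⁻ x, ∏ i, w i (x i) ∂(Measure.pi μ) = ∏ i, ∫⁻ y, w i y ∂(μ i) := by
  have hind : iIndepFun (fun i (x : ∀ i, X i) => w i (x i)) (Measure.pi μ) :=
    iIndepFun_pi fun i => (hw i).aemeasurable
  have := lintegral_prod_eq_prod_lintegral_of_indepFun Finset.univ _ hind
    fun i => (hw i).comp (measurable_pi_apply i)
  refine this.trans (Finset.prod_congr rfl fun i _ => ?_)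
  exact (measurePreserving_eval μ i).lintegral_comp (hw i)

/-- The integral of the weight of an action-observation path with respect to a distribution over
local policies. -/
def meanWeight {i : Fin D.N} (μi : ProbabilityMeasure (LocalPolicy D i)) {t : ℕ} (ht : t ≤ D.T)
    (τ : Fin t → D.A i × D.Ob i) (a : D.A i) : ℝ≥0∞ :=
  ∫⁻ p, pathWeight ht τ a p ∂(μi : Measure (LocalPolicy D i))

lemma lintegral_prob (i : Fin D.N) (μi : ProbabilityMeasure (LocalPolicy D i))
    (ν : ∀ j, ProbabilityMeasure (LocalPolicy D j)) {t : ℕ} (ht : t ≤ D.T) (h : History D t) :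
    ∫⁻ π, prob π ht h ∂(withOpponents i μi ν) =
      meanWeight μi ht (h.ao i t le_rfl) (h.act (Fin.last t) i) * (envProb h *
        ∏ j ∈ Finset.univ.erase i, meanWeight (ν j) ht (h.ao j t le_rfl) (h.act (Fin.last t) j)) := by
  simp only [prob_eq_envProb_mul]
  have hm : Measurable fun π : Policy D =>
      ∏ j, pathWeight ht (h.ao j t le_rfl) (h.act (Fin.last t) j) (π j) :=
    Finset.measurable_prod _ fun j _ =>
      (measurable_pathWeight ht _ _).comp (measurable_pi_apply j)
  rw [lintegral_const_mul _ hm]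
  unfold withOpponents
  rw [lintegral_pi_prod _ _ fun j => measurable_pathWeight _ _ _,
    ← Finset.mul_prod_erase _ _ (Finset.mem_univ i), mul_left_comm]
  congr 1
  · simp [meanWeight]
  · congr 1
    refine Finset.prod_congr rfl fun j hj => ?_
    rw [Function.update_of_ne (Finset.ne_of_mem_erase hj)]
    rfl

open Classical in
/-- The contribution of the environment and the opponents to the probability of the event
`A_{i,t} = a, AO_{i,t} = τ`. -/
def opponentWeight (i : Fin D.N) (ν : ∀ j, ProbabilityMeasure (LocalPolicy D j)) {t : ℕ}
    (ht : t ≤ D.T) (τ : Fin t → D.A i × D.Ob i) (a : D.A i) : ℝ≥0∞ :=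
  ∑ h : History D t, if h ∈ actEvent i t a ∩ aoEvent i t τ then envProb h *
    ∏ j ∈ Finset.univ.erase i, meanWeight (ν j) ht (h.ao j t le_rfl) (h.act (Fin.last t) j) else 0

lemma mixProb_act_ao (i : Fin D.N) (μi : ProbabilityMeasure (LocalPolicy D i))
    (ν : ∀ j, ProbabilityMeasure (LocalPolicy D j)) {t : ℕ} (ht : t ≤ D.T)
    (τ : Fin t → D.A i × D.Ob i) (a : D.A i) :
    mixProb (withOpponents i μi ν) ht (actEvent i t a ∩ aoEvent i t τ) =
      meanWeight μi ht τ a * opponentWeight i ν ht τ a := by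
  unfold mixProb opponentWeight
  rw [Finset.mul_sum]
  refine Finset.sum_congr rfl fun h _ => ?_
  split_ifs with hh
  · obtain ⟨ha, hτ⟩ := hh
    rw [lintegral_prob]
    rw [show h.ao i t le_rfl = τ from hτ, show h.act (Fin.last t) i = a from ha]
  · simp

/-- Replace the last action of agent `i`, and the last reward accordingly. -/
def History.setLast (i : Fin D.N) (a : D.A i) {t : ℕ} (h : History D t) : History D t where
  state := h.state
  act := Function.update h.act (Fin.last t) (Function.update (h.act (Fin.last t)) i a)
  rew := Function.update h.rew (Fin.last t) ⟨D.R (h.state (Fin.last t))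
    (Function.update (h.act (Fin.last t)) i a), ⟨(_, _), rfl⟩⟩
  obs := h.obs

namespace History

variable {t : ℕ}

lemma setLast_act_castSucc (i : Fin D.N) (a : D.A i) (h : History D t) (s : Fin t) :
    (h.setLast i a).act s.castSucc = h.act s.castSucc :=
  Function.update_of_ne s.castSucc_ne_last _ _

lemma setLast_act_last (i : Fin D.N) (a : D.A i) (h : History D t) :
    (h.setLast i a).act (Fin.last t) = Function.update (h.act (Fin.last t)) i a :=
  Function.update_self _ _ _

lemma setLast_ao (i : Fin D.N) (a : D.A i) (h : History D t) (j : Fin D.N) :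
    (h.setLast i a).ao j t le_rfl = h.ao j t le_rfl := by
  funext r
  exact Prod.ext (congrFun (setLast_act_castSucc i a h r) j) rfl

/-- The last reward is the one prescribed by the reward function. -/
def LastConsistent (h : History D t) : Prop :=
  (h.rew (Fin.last t) : ℝ) = D.R (h.state (Fin.last t)) (h.act (Fin.last t))

lemma setLast_lastConsistent (i : Fin D.N) (a : D.A i) (h : History D t) :
    (h.setLast i a).LastConsistent := by
  simp [LastConsistent, setLast]

lemma setLast_setLast (i : Fin D.N) (a b : D.A i) (h : History D t) (hc : h.LastConsistent)
    (hb : h.act (Fin.last t) i = b) : (h.setLast i a).setLast i b = h := by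
  subst hb
  ext1 s
  · rfl
  · simp [setLast]
  · by_cases hs : s = Fin.last t
    · subst hs
      simpa [setLast] using hc.symm
    · simp [setLast, hs]
  · rfl

lemma envProb_setLast (i : Fin D.N) (a : D.A i) (h : History D t) (hc : h.LastConsistent) :
    envProb (h.setLast i a) = envProb h := by
  unfold envProb
  rw [Fin.prod_univ_castSucc, Fin.prod_univ_castSucc (n := t)]
  simp only [setLast_act_castSucc]
  rw [if_pos (show _ = _ from setLast_lastConsistent i a h), if_pos (show _ = _ from hc)]
  refine congrArg₂ _ rfl (congrArg₂ _ (Finset.prod_congr rfl fun s _ => ?_) rfl)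
  rw [show (h.setLast i a).rew s.castSucc = h.rew s.castSucc from
    Function.update_of_ne s.castSucc_ne_last _ _]
  rfl

lemma lastConsistent_of_envProb_ne_zero (h : History D t) (he : envProb h ≠ 0) :
    h.LastConsistent := by
  by_contra hc
  refine he ?_
  unfold envProb
  rw [Finset.prod_eq_zero (Finset.mem_univ (Fin.last t)) (if_neg hc), mul_zero]

end History

/-- The last action of agent `i` influences only the last reward. Histories with an inconsistent
last reward have weight zero and can be dropped; on the others, exchanging the last action and
correcting the last reward is a weight-preserving bijection. -/
lemma opponentWeight_congr (i : Fin D.N) (ν : ∀ j, ProbabilityMeasure (LocalPolicy D j)) {t : ℕ}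
    (ht : t ≤ D.T) (τ : Fin t → D.A i × D.Ob i) (a b : D.A i) :
    opponentWeight i ν ht τ a = opponentWeight i ν ht τ b := by
  classical
  have key : ∀ c : D.A i, opponentWeight i ν ht τ c =
      ∑ h ∈ Finset.univ.filter fun h : History D t =>
          h.LastConsistent ∧ h ∈ actEvent i t c ∩ aoEvent i t τ,
        envProb h * ∏ j ∈ Finset.univ.erase i,
          meanWeight (ν j) ht (h.ao j t le_rfl) (h.act (Fin.last t) j) := by
    intro c
    unfold opponentWeight
    rw [Finset.sum_filter]
    refine Finset.sum_congr rfl fun h _ => ?_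
    by_cases hc : h.LastConsistent
    · simp [hc]
    · have : envProb h = 0 := by
        by_contra he
        exact hc (h.lastConsistent_of_envProb_ne_zero he)
      simp [hc, this]
  rw [key a, key b]
  refine Finset.sum_nbij' (fun h => h.setLast i b) (fun h => h.setLast i a) ?_ ?_ ?_ ?_ ?_
  · intro h hh
    obtain ⟨-, hc, ha, hτ⟩ := Finset.mem_filter.1 hh
    refine Finset.mem_filter.2 ⟨Finset.mem_univ _, h.setLast_lastConsistent i b, ?_, ?_⟩
    · simp [actEvent, History.setLast_act_last]
    · exact (h.setLast_ao i b i).trans hτ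
  · intro h hh
    obtain ⟨-, hc, ha, hτ⟩ := Finset.mem_filter.1 hh
    refine Finset.mem_filter.2 ⟨Finset.mem_univ _, h.setLast_lastConsistent i a, ?_, ?_⟩
    · simp [actEvent, History.setLast_act_last]
    · exact (h.setLast_ao i a i).trans hτ
  · intro h hh
    obtain ⟨-, hc, ha, hτ⟩ := Finset.mem_filter.1 hh
    exact h.setLast_setLast i b a hc ha
  · intro h hh
    obtain ⟨-, hc, ha, hτ⟩ := Finset.mem_filter.1 hh
    exact h.setLast_setLast i a b hc ha
  · intro h hh
    obtain ⟨-, hc, ha, hτ⟩ := Finset.mem_filter.1 hh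
    rw [h.envProb_setLast i b hc]
    congr 1
    refine Finset.prod_congr rfl fun j hj => ?_
    rw [h.setLast_ao, h.setLast_act_last, Function.update_of_ne (Finset.ne_of_mem_erase hj)]

/-- The total weight of an action-observation history. -/
def totalWeight {i : Fin D.N} (μi : ProbabilityMeasure (LocalPolicy D i)) {t : ℕ} (ht : t ≤ D.T)
    (τ : Fin t → D.A i × D.Ob i) : ℝ≥0∞ :=
  ∑' a, meanWeight μi ht τ a

/-- By `opponentWeight_congr` the opponents' weight is a common factor of the sum over last actions;
the parameter `a` is an arbitrary witness. -/
lemma mixProb_ao (i : Fin D.N) (μi : ProbabilityMeasure (LocalPolicy D i))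
    (ν : ∀ j, ProbabilityMeasure (LocalPolicy D j)) {t : ℕ} (ht : t ≤ D.T)
    (τ : Fin t → D.A i × D.Ob i) (a : D.A i) :
    mixProb (withOpponents i μi ν) ht (aoEvent i t τ) =
      totalWeight μi ht τ * opponentWeight i ν ht τ a := by
  rw [← tsum_mixProb, totalWeight, ← ENNReal.tsum_mul_right]
  refine tsum_congr fun b => ?_
  rw [mixProb_act_ao, opponentWeight_congr i ν ht τ b a]

/-- Some history with positive environment probability has the given action-observation history
of agent `i`. -/
def Reachable (i : Fin D.N) {t : ℕ} (τ : Fin t → D.A i × D.Ob i) : Prop :=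
  ∃ h : History D t, h.ao i t le_rfl = τ ∧ envProb h ≠ 0

/-- The uniformly random local policy. -/
def uniformLocal (D : DecPOMDP) (i : Fin D.N) : LocalPolicy D i := fun _ _ _ =>
  letI := Fintype.ofFinite (D.A i)
  PMF.uniformOfFintype (D.A i)

lemma pathWeight_uniformLocal_ne_zero {i : Fin D.N} {t : ℕ} (ht : t ≤ D.T)
    (τ : Fin t → D.A i × D.Ob i) (a : D.A i) : pathWeight ht τ a (uniformLocal D i) ≠ 0 := by
  unfold pathWeight uniformLocal
  refine mul_ne_zero (Finset.prod_ne_zero_iff.2 fun s _ => ?_) ?_ <;> simp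

/-- Opponents acting uniformly at random give every joint action positive probability, so only the
environment and `μi` can rule out a history. The criterion no longer mentions opponents. -/
lemma exists_opponents_iff (i : Fin D.N) (μi : ProbabilityMeasure (LocalPolicy D i)) {t : ℕ}
    (ht : t ≤ D.T) (τ : Fin t → D.A i × D.Ob i) :
    (∃ ν : ∀ j, ProbabilityMeasure (LocalPolicy D j),
      mixProb (withOpponents i μi ν) ht (aoEvent i t τ) ≠ 0) ↔
      Reachable i τ ∧ totalWeight μi ht τ ≠ 0 := by
  classical
  constructor
  · rintro ⟨ν, hν⟩
    rw [mixProb_ao i μi ν ht τ (Classical.arbitrary _)] at hν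
    refine ⟨?_, left_ne_zero_of_mul hν⟩
    obtain ⟨h, -, hh⟩ := Finset.exists_ne_zero_of_sum_ne_zero (right_ne_zero_of_mul hν)
    split_ifs at hh with hm
    · exact ⟨h, hm.2, left_ne_zero_of_mul hh⟩
    · exact absurd rfl hh
  · rintro ⟨⟨h, hτ, he⟩, hw⟩
    let ν : ∀ j, ProbabilityMeasure (LocalPolicy D j) :=
      fun j => ⟨Measure.dirac (uniformLocal D j), inferInstance⟩
    refine ⟨ν, ?_⟩
    rw [mixProb_ao i μi ν ht τ (h.act (Fin.last t) i)]
    refine mul_ne_zero hw ?_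
    unfold opponentWeight
    refine fun h0 => absurd (Finset.sum_eq_zero_iff.1 h0 h (Finset.mem_univ _)) ?_
    rw [if_pos ⟨rfl, hτ⟩]
    refine mul_ne_zero he (Finset.prod_ne_zero_iff.2 fun j _ => ?_)
    unfold meanWeight
    change ∫⁻ p, _ ∂(Measure.dirac (uniformLocal D j)) ≠ 0
    rw [lintegral_dirac' _ (measurable_pathWeight _ _ _)]
    exact pathWeight_uniformLocal_ne_zero _ _ _

open Classical in
/-- An explicit formula for the policy corresponding to a distribution over local policies. -/
lemma mixtureLocal_apply (i : Fin D.N) (μi : ProbabilityMeasure (LocalPolicy D i)) {t : ℕ}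
    (ht : t ≤ D.T) (τ : Fin t → D.A i × D.Ob i) (a : D.A i) :
    mixtureLocal i μi t ht τ a =
      if Reachable i τ ∧ totalWeight μi ht τ ≠ 0 then meanWeight μi ht τ a / totalWeight μi ht τ
      else (Nat.card (D.A i) : ℝ≥0∞)⁻¹ := by
  unfold mixtureLocal
  by_cases hex : ∃ ν : ∀ j, ProbabilityMeasure (LocalPolicy D j),
      mixProb (withOpponents i μi ν) ht (aoEvent i t τ) ≠ 0
  · rw [dif_pos hex, if_pos ((exists_opponents_iff i μi ht τ).1 hex)]
    change mixProb _ ht _ / mixProb _ ht _ = _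
    have h0 := hex.choose_spec
    have htop := mixProb_ne_top (withOpponents i μi hex.choose) ht (aoEvent i t τ)
    rw [mixProb_ao i μi _ ht τ a] at h0 htop ⊢
    rw [mixProb_act_ao]
    -- The weight of the chosen opponents cancels: it is nonzero by `h0`, and it is finite because
    -- its product with the nonzero total weight is a probability.
    have h1 := right_ne_zero_of_mul h0
    refine ENNReal.mul_div_mul_right _ _ h1 fun h2 => htop ?_
    rw [h2, ENNReal.mul_top (left_ne_zero_of_mul h0)]
  · rw [dif_neg hex, if_neg fun h => hex ((exists_opponents_iff i μi ht τ).2 h)]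
    let _ := Fintype.ofFinite (D.A i)
    rw [Nat.card_eq_fintype_card]
    exact PMF.uniformOfFintype_apply a

end

section

/-! ### Equivariance of history probabilities and of the symmetrizer -/

variable {D E F : DecPOMDP}

lemma pushPolicy_comp (f : Iso D E) (g : Iso E F) (π : Policy D) :
    pushPolicy (f.comp g) π = pushPolicy g (pushPolicy f π) := by
  funext j t ht τ
  exact (PMF.map_comp (f.A (g.N.symm j)) _ (g.A j)).symm

lemma pushPolicy_refl (π : Policy D) : pushPolicy (Iso.refl D) π = π := by
  funext j t ht τ
  exact PMF.map_id _

lemma pushPolicy_apply (f : Iso D E) (π : Policy D) (j : Fin E.N) {t : ℕ} (ht : t ≤ D.T)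
    (ht' : t ≤ E.T) (τ : Fin t → D.A (f.N.symm j) × D.Ob (f.N.symm j)) (a : D.A (f.N.symm j)) :
    pushPolicy f π j t ht' (fun r => (f.A j (τ r).1, f.Ob j (τ r).2)) (f.A j a) =
      π (f.N.symm j) t ht τ a := by
  unfold pushPolicy
  rw [Labeling.map_equiv_apply]
  congr 2
  funext s
  exact Prod.ext (Equiv.symm_apply_apply _ _) (Equiv.symm_apply_apply _ _)

lemma pathWeight_pushPolicy (f : Iso D E) (π : Policy D) (j : Fin E.N) {t : ℕ} (ht : t ≤ D.T)
    (ht' : t ≤ E.T) (τ : Fin t → D.A (f.N.symm j) × D.Ob (f.N.symm j)) (a : D.A (f.N.symm j)) :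
    pathWeight ht' (fun r => (f.A j (τ r).1, f.Ob j (τ r).2)) (f.A j a) (pushPolicy f π j) =
      pathWeight ht τ a (π (f.N.symm j)) := by
  unfold pathWeight
  refine congrArg₂ _ (Finset.prod_congr rfl fun s _ => ?_) ?_
  · exact pushPolicy_apply f π j _ _ (fun r : Fin s => τ ⟨r, by omega⟩) _
  · exact pushPolicy_apply f π j _ _ τ a

lemma envProb_map (f : Iso D E) {t : ℕ} (h : History D t) :
    envProb (History.map f h) = envProb h := by
  unfold envProb
  refine congrArg₂ _ (congrArg₂ _ (f.init _).symm (Finset.prod_congr rfl fun s _ => ?_))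
    (Finset.prod_congr rfl fun s _ => ?_)
  · exact congrArg₂ _ (f.trans _ _ _).symm (f.obser _ _ _).symm
  · rw [f.reward]
    rfl

lemma prob_map (f : Iso D E) (π : Policy D) {t : ℕ} (ht : t ≤ D.T) (ht' : t ≤ E.T)
    (h : History D t) : prob (pushPolicy f π) ht' (History.map f h) = prob π ht h := by
  rw [prob_eq_envProb_mul, prob_eq_envProb_mul, envProb_map]
  congr 1
  rw [← Equiv.prod_comp f.N.symm]
  refine Finset.prod_congr rfl fun j _ => ?_
  exact pathWeight_pushPolicy f π j ht ht' (h.ao (f.N.symm j) t le_rfl)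
    (h.act (Fin.last t) (f.N.symm j))

lemma prob_cast (π : Policy D) {t t' : ℕ} (e : t = t') (ht : t ≤ D.T) (ht' : t' ≤ D.T)
    (h : History D t) : prob π ht' (h.cast e) = prob π ht h := by
  subst e; rfl

lemma prob_onEpisode (f : Iso D E) (π : Policy D) (τ : Episode D) :
    prob (pushPolicy f π) le_rfl (f.onEpisode τ) = prob π le_rfl τ := by
  unfold Iso.onEpisode
  rw [prob_cast _ f.horizon f.horizon.le, prob_map f π le_rfl]

lemma reachable_iff (f : Iso D E) (j : Fin E.N) {t : ℕ}
    (τ : Fin t → D.A (f.N.symm j) × D.Ob (f.N.symm j)) :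
    Reachable j (fun r => (f.A j (τ r).1, f.Ob j (τ r).2)) ↔ Reachable (f.N.symm j) τ := by
  constructor
  · rintro ⟨h, hτ, he⟩
    refine ⟨History.map f.inv h, ?_, by rwa [envProb_map]⟩
    rw [← History.map_map_inv f h, History.ao_map] at hτ
    funext r
    have := congrFun hτ r
    exact Prod.ext ((f.A j).injective (congrArg Prod.fst this))
      ((f.Ob j).injective (congrArg Prod.snd this))
  · rintro ⟨h, hτ, he⟩
    refine ⟨History.map f h, ?_, by rwa [envProb_map]⟩
    rw [History.ao_map, hτ]

lemma meanWeight_opMarginal (π : Policy D) (i : Fin D.N) {t : ℕ} (ht : t ≤ D.T)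
    (τ : Fin t → D.A i × D.Ob i) (a : D.A i) :
    meanWeight (opMarginal π i) ht τ a = ∑ g : Fin D.N → Aut D,
      pathWeight ht τ a (pushPolicy (g i) π i) * (Fintype.card (Fin D.N → Aut D) : ℝ≥0∞)⁻¹ := by
  let _ : MeasurableSpace (Fin D.N → Aut D) := ⊤
  have h : (opMarginal π i : Measure (LocalPolicy D i)) =
      (PMF.uniformOfFintype (Fin D.N → Aut D)).toMeasure.map
        (fun g => pushProfile g π i) := by
    rw [PMF.toMeasure_map (hf := measurable_from_top)]
    change PMF.toMeasure _ = _
    unfold opDist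
    rw [PMF.map_comp]
    rfl
  unfold meanWeight
  rw [h, lintegral_map (measurable_pathWeight ht τ a) measurable_from_top, lintegral_fintype]
  refine Finset.sum_congr rfl fun g _ => ?_
  rw [PMF.toMeasure_apply_singleton _ _ (MeasurableSet.singleton g), PMF.uniformOfFintype_apply]
  rfl

/-- Following `f` by the automorphisms of `E` gives each element of `Iso D E` exactly once. The
right side no longer depends on `f`, which yields invariance under automorphisms when `E = D`. -/
lemma meanWeight_opMarginal_pushPolicy (f : Iso D E) (π : Policy D) (j : Fin E.N) {t : ℕ}
    (ht : t ≤ E.T) (τ : Fin t → E.A j × E.Ob j) (a : E.A j) :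
    meanWeight (opMarginal (pushPolicy f π) j) ht τ a = ∑ g : Fin E.N → Iso D E,
      pathWeight ht τ a (pushPolicy (g j) π j) * (Fintype.card (Fin E.N → Iso D E) : ℝ≥0∞)⁻¹ := by
  let e : (Fin E.N → Aut E) ≃ (Fin E.N → Iso D E) :=
    Equiv.arrowCongr (Equiv.refl _) f.compLeftEquiv
  rw [meanWeight_opMarginal, ← Equiv.sum_comp e, Fintype.card_congr e]
  refine Finset.sum_congr rfl fun g _ => ?_
  rw [← pushPolicy_comp]
  rfl

/-- The same average over `Iso D E` is reached from the other side, by following automorphisms of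
`D` with `f`. -/
lemma meanWeight_opMarginal_iso (f : Iso D E) (π : Policy D) (j : Fin E.N) {t : ℕ} (ht : t ≤ D.T)
    (ht' : t ≤ E.T) (τ : Fin t → D.A (f.N.symm j) × D.Ob (f.N.symm j)) (a : D.A (f.N.symm j)) :
    meanWeight (opMarginal (pushPolicy f π) j) ht' (fun r => (f.A j (τ r).1, f.Ob j (τ r).2))
      (f.A j a) = meanWeight (opMarginal π (f.N.symm j)) ht τ a := by
  let e : (Fin D.N → Aut D) ≃ (Fin E.N → Iso D E) := Equiv.arrowCongr f.N f.compRightEquiv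
  rw [meanWeight_opMarginal_pushPolicy, meanWeight_opMarginal, ← Equiv.sum_comp e,
    Fintype.card_congr e]
  refine Finset.sum_congr rfl fun g _ => ?_
  rw [← pathWeight_pushPolicy f (pushPolicy (g (f.N.symm j)) π) j ht ht' τ a, ← pushPolicy_comp]
  rfl

/-- The symmetrizer only depends on the orbit of a policy under automorphisms. -/
lemma symmetrizer_pushPolicy_aut (f : Aut D) (π : Policy D) :
    symmetrizer (pushPolicy f π) = symmetrizer π := by
  have h : ∀ (j : Fin D.N) {t : ℕ} (ht : t ≤ D.T) (τ : Fin t → D.A j × D.Ob j),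
      meanWeight (opMarginal (pushPolicy f π) j) ht τ = meanWeight (opMarginal π j) ht τ := by
    intro j t ht τ
    funext a
    -- Both sides are now pushforwards of `π` by automorphisms, and
    -- `meanWeight_opMarginal_pushPolicy` gives the same expression for every such pushforward.
    conv_rhs => rw [← pushPolicy_refl π]
    rw [meanWeight_opMarginal_pushPolicy, meanWeight_opMarginal_pushPolicy]
  funext j t ht τ
  ext a
  unfold symmetrizer
  rw [mixtureLocal_apply, mixtureLocal_apply]
  unfold totalWeight
  rw [h]

/-- The symmetrizer commutes with isomorphisms. -/
lemma symmetrizer_pushPolicy (f : Iso D E) (π : Policy D) :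
    symmetrizer (pushPolicy f π) = pushPolicy f (symmetrizer π) := by
  funext j t ht' τ'
  have ht : t ≤ D.T := ht'.trans_eq f.horizon.symm
  obtain ⟨τ, rfl⟩ : ∃ τ : Fin t → D.A (f.N.symm j) × D.Ob (f.N.symm j),
      τ' = fun r => (f.A j (τ r).1, f.Ob j (τ r).2) :=
    ⟨fun r => ((f.A j).symm (τ' r).1, (f.Ob j).symm (τ' r).2), by simp⟩
  ext a'
  obtain ⟨a, rfl⟩ := (f.A j).surjective a'
  rw [pushPolicy_apply f _ j ht]
  unfold symmetrizer
  rw [mixtureLocal_apply, mixtureLocal_apply]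
  have hT : totalWeight (opMarginal (pushPolicy f π) j) ht'
      (fun r => (f.A j (τ r).1, f.Ob j (τ r).2)) =
        totalWeight (opMarginal π (f.N.symm j)) ht τ := by
    unfold totalWeight
    rw [← (f.A j).tsum_eq]
    exact tsum_congr fun b => meanWeight_opMarginal_iso f π j ht ht' τ b
  rw [hT, reachable_iff, meanWeight_opMarginal_iso f π j ht ht' τ a, Nat.card_congr (f.A j)]

/-- History probabilities of symmetrized policies are invariant under automorphisms. -/
lemma prob_symmetrizer_onEpisode (f : Aut D) (π : Policy D) (τ : Episode D) :
    prob (symmetrizer π) le_rfl (f.onEpisode τ) = prob (symmetrizer π) le_rfl τ := by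
  rw [← prob_onEpisode f (symmetrizer π) τ, ← symmetrizer_pushPolicy, symmetrizer_pushPolicy_aut]

end

section

/-! ### Order of first occurrence -/

section FirstOccurrence

variable {α β : Type} {n : ℕ}

/-- The numbering sees only which entries coincide, and injections preserve that. The casts serve
horizons that are equal only propositionally. -/
lemma firstOccurrence_comp {m : ℕ} (e : n = m) (φ : α → β) (hφ : Function.Injective φ)
    (x : Fin n → α) (s : Fin m) :
    firstOccurrence (fun r : Fin m => φ (x (r.cast e.symm))) s =
      firstOccurrence x (s.cast e.symm) := by
  subst e
  unfold firstOccurrence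
  rw [← Set.ncard_image_of_injective _ hφ, Set.image_image]
  simp only [Fin.cast_eq_self, hφ.ne_iff]

lemma firstOccurrence_lt [Finite α] (x : Fin n → α) (t : Fin n) :
    firstOccurrence x t < Nat.card α := by
  unfold firstOccurrence
  rw [← Set.ncard_univ]
  refine Set.ncard_lt_ncard (Set.ssubset_univ_iff.2 fun h => ?_) Set.finite_univ
  obtain ⟨s, hs, he⟩ := h.symm ▸ Set.mem_univ (x t)
  exact hs s le_rfl he

lemma firstOccurrence_congr (x : Fin n → α) {t t' : Fin n} (h : x t = x t') :
    firstOccurrence x t = firstOccurrence x t' := by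
  unfold firstOccurrence
  rw [h]

/-- The times before a first occurrence form an initial segment, so two such segments are nested. If
they show equally many values, they show the same values. For distinct entries this fails: the one
occurring first is shown before the other, but not before itself. -/
lemma eq_of_firstOccurrence_eq (x : Fin n → α) {t t' : Fin n}
    (h : firstOccurrence x t = firstOccurrence x t') : x t = x t' := by
  let I : Fin n → Set (Fin n) := fun t => {s | ∀ r ≤ s, x r ≠ x t}
  have hlower : ∀ t, IsLowerSet (I t) := fun t s s' hs' hs r hr => hs r (hr.trans hs')
  have key : ∀ t t', firstOccurrence x t = firstOccurrence x t' → I t ⊆ I t' → x t = x t' := by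
    intro t t' h hI
    have heq : x '' I t = x '' I t' :=
      Set.eq_of_subset_of_ncard_le (Set.image_mono hI) h.ge (Set.toFinite _)
    by_contra hne
    obtain ⟨m, hm, hmin⟩ := (Set.toFinite {s | x s = x t}).exists_minimal ⟨t, rfl⟩
    have hmt : x m = x t := hm
    have hm' : m ∉ I t' := by
      intro hm'
      obtain ⟨s, hs, he⟩ := heq.symm ▸ Set.mem_image_of_mem x hm'
      exact hs s le_rfl (he.trans hmt)
    obtain ⟨r, hr, hrt⟩ : ∃ r ≤ m, x r = x t' := by
      simpa [I] using hm'
    have hrI : r ∈ I t := by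
      intro q hq hqt
      have hmq : m ≤ q := hmin hqt (hq.trans hr)
      have : r = m := le_antisymm hr (hmq.trans hq)
      exact hne (by rw [← hmt, ← this, hrt])
    exact hI hrI r le_rfl hrt
  rcases (hlower t).total (hlower t') with hI | hI
  · exact key t t' h hI
  · exact (key t' t h.symm hI).symm

/-- The numbering is injective on the values that occur, and an injection on a subset extends to a
bijection between finite sets of equal size. -/
lemma exists_equiv_firstOccurrence [Finite α] (x : Fin n → α) :
    ∃ e : α ≃ Fin (Nat.card α), ∀ t, (e (x t) : ℕ) = firstOccurrence x t := by
  classical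
  let _ := Fintype.ofFinite α
  let f : α → Fin (Nat.card α) := fun a =>
    if h : ∃ t, x t = a then ⟨firstOccurrence x h.choose, firstOccurrence_lt x _⟩
    else ⟨0, Nat.card_pos_iff.2 ⟨⟨a⟩, inferInstance⟩⟩
  have hf : ∀ t, (f (x t) : ℕ) = firstOccurrence x t := by
    intro t
    have h : ∃ t', x t' = x t := ⟨t, rfl⟩
    simp only [f, dif_pos h]
    exact firstOccurrence_congr x h.choose_spec
  have hinj : Set.InjOn f (Finset.univ.image x : Finset α) := by
    intro a ha b hb hab
    obtain ⟨t, -, rfl⟩ := Finset.mem_image.1 ha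
    obtain ⟨t', -, rfl⟩ := Finset.mem_image.1 hb
    exact eq_of_firstOccurrence_eq x (by rw [← hf, ← hf, hab])
  obtain ⟨g, hg⟩ := Finset.exists_equiv_extend_of_card_eq
    (t := (Finset.univ : Finset (Fin (Nat.card α)))) (by simp [Nat.card_eq_fintype_card])
    (Finset.subset_univ _) hinj
  refine ⟨g.trans (Equiv.subtypeUnivEquiv fun a => Finset.mem_univ a), fun t => ?_⟩
  rw [← hf, ← hg _ (Finset.mem_image_of_mem x (Finset.mem_univ t))]
  rfl

end FirstOccurrence

/-! ### Labelings along isomorphisms -/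

variable {D E L L' : DecPOMDP}

/-- The agent permutation acts on both sides of the defining equation, so it drops out and leaves
one condition per original agent. -/
lemma mem_normalLabelings (τ : Episode D) (g : Labeling D.toFrame) :
    g ∈ normalLabelings τ ↔
      (∀ s, (g.S (τ.state s) : ℕ) = firstOccurrence τ.state s) ∧
      (∀ i s, (g.A i (τ.act s i) : ℕ) = firstOccurrence (fun r => τ.act r i) s) ∧
      (∀ i s, (g.Ob i (τ.obs s i) : ℕ) = firstOccurrence (fun r => τ.obs r i) s) := by
  classical
  refine Finset.mem_filter.trans ?_
  constructor
  · rintro ⟨-, h⟩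
    refine ⟨fun s => congrFun (congrArg NumHistory.state h) s, fun i s => ?_, fun i s => ?_⟩
    · obtain ⟨j, rfl⟩ := g.N.symm.surjective i
      exact congrFun (congrFun (congrArg NumHistory.act h) s) j
    · obtain ⟨j, rfl⟩ := g.N.symm.surjective i
      exact congrFun (congrFun (congrArg NumHistory.obs h) s) j
  · rintro ⟨hs, ha, ho⟩
    refine ⟨Finset.mem_univ _, ?_⟩
    unfold Labeling.numbers normalForm NumHistory.permute
    rw [NumHistory.mk.injEq]
    exact ⟨funext hs, funext fun s => funext fun j => ha (g.N.symm j) s, rfl,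
      funext fun s => funext fun j => ho (g.N.symm j) s⟩

lemma normalLabelings_nonempty (τ : Episode D) : (normalLabelings τ).Nonempty := by
  obtain ⟨s, hs⟩ := exists_equiv_firstOccurrence τ.state
  choose a ha using fun i => exists_equiv_firstOccurrence (fun r => τ.act r i)
  choose o ho using fun i => exists_equiv_firstOccurrence (fun r => τ.obs r i)
  exact ⟨⟨Equiv.refl _, s, a, o⟩, (mem_normalLabelings τ _).2 ⟨hs, ha, ho⟩⟩

namespace Labeling

variable {X Y : Frame}

/-- The labeling `g ∘ f` of `X` obtained from a labeling `g` of `Y` and bijections `f` from `X`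
to `Y`. -/
def pull (f : Bij X Y) (g : Labeling Y) : Labeling X where
  N := f.N.trans (g.N.trans (finCongr (Fin.equiv_iff_eq.1 ⟨f.N⟩).symm))
  S := (f.S.trans g.S).trans (finCongr (Nat.card_congr f.S).symm)
  A i := ((f.fA (f.N.symm_apply_apply i)).trans (g.A (f.N i))).trans
    (finCongr (Nat.card_congr (f.fA (f.N.symm_apply_apply i))).symm)
  Ob i := ((f.fO (f.N.symm_apply_apply i)).trans (g.Ob (f.N i))).trans
    (finCongr (Nat.card_congr (f.fO (f.N.symm_apply_apply i))).symm)

lemma pull_injective (f : Bij X Y) : Function.Injective (pull f) := by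
  rintro ⟨n, s, a, o⟩ ⟨n', s', a', o'⟩ h
  simp only [pull, Labeling.mk.injEq] at h
  obtain ⟨hn, hs, ha, ho⟩ := h
  rw [Labeling.mk.injEq]
  refine ⟨?_, ?_, funext fun j => ?_, funext fun j => ?_⟩
  · ext x
    obtain ⟨i, rfl⟩ := f.N.surjective x
    simpa using congrArg (fun e => ((e i : Fin X.N) : ℕ)) hn
  · ext x
    obtain ⟨i, rfl⟩ := f.S.surjective x
    simpa using congrArg (fun e => ((e i : Fin _) : ℕ)) hs
  · obtain ⟨i, rfl⟩ := f.N.surjective j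
    ext x
    obtain ⟨y, rfl⟩ := (f.fA (f.N.symm_apply_apply i)).surjective x
    simpa using congrArg (fun e => ((e y : Fin _) : ℕ)) (congrFun ha i)
  · obtain ⟨i, rfl⟩ := f.N.surjective j
    ext x
    obtain ⟨y, rfl⟩ := (f.fO (f.N.symm_apply_apply i)).surjective x
    simpa using congrArg (fun e => ((e y : Fin _) : ℕ)) (congrFun ho i)

/-- Pulling back along `f` and along `f.inv` gives injections both ways between finite sets, so the
cardinalities agree. -/
lemma pull_bijective (f : Bij X Y) : Function.Bijective (pull f) :=
  (Fintype.bijective_iff_injective_and_card _).2 ⟨pull_injective f,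
    le_antisymm (Fintype.card_le_of_injective _ (pull_injective f))
      (Fintype.card_le_of_injective _ (pull_injective f.inv))⟩

lemma pull_A_val (f : Bij X Y) (g : Labeling Y) {i : Fin X.N} {j : Fin Y.N} (h : f.N.symm j = i)
    (a : X.A i) : ((pull f g).A i a : ℕ) = g.A j (f.fA h a) := by
  obtain rfl : f.N i = j := by rw [← h, Equiv.apply_symm_apply]
  rfl

lemma pull_Ob_val (f : Bij X Y) (g : Labeling Y) {i : Fin X.N} {j : Fin Y.N} (h : f.N.symm j = i)
    (o : X.Ob i) : ((pull f g).Ob i o : ℕ) = g.Ob j (f.fO h o) := by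
  obtain rfl : f.N i = j := by rw [← h, Equiv.apply_symm_apply]
  rfl

lemma toBij_fA_val (g : Labeling X) {i : Fin X.N} {j : Fin g.frame.N} (h : g.toBij.N.symm j = i)
    (a : X.A i) :
    Fin.val (n := Nat.card (X.A (g.N.symm j))) (g.toBij.fA h a) = (g.A i a : ℕ) := by
  subst h; rfl

lemma toBij_fO_val (g : Labeling X) {i : Fin X.N} {j : Fin g.frame.N} (h : g.toBij.N.symm j = i)
    (o : X.Ob i) :
    Fin.val (n := Nat.card (X.Ob (g.N.symm j))) (g.toBij.fO h o) = (g.Ob i o : ℕ) := by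
  subst h; rfl

lemma pull_mem_normalLabelings (f : Iso D E) (g : Labeling E.toFrame) (τ : Episode D) :
    pull f.toBij g ∈ normalLabelings τ ↔ g ∈ normalLabelings (f.onEpisode τ) := by
  have e := f.horizon
  have e' : D.T + 1 = E.T + 1 := by rw [e]
  rw [mem_normalLabelings, mem_normalLabelings]
  refine and_congr ?_ (and_congr ?_ ?_)
  · rw [(finCongr e'.symm).surjective.forall]
    refine forall_congr' fun s => ?_
    have h1 := firstOccurrence_comp e' f.S f.S.injective τ.state s
    change _ ↔ _ = firstOccurrence (fun r : Fin (E.T + 1) => f.S (τ.state (r.cast e'.symm))) s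
    rw [h1]
    rfl
  · rw [f.N.symm.surjective.forall]
    refine forall_congr' fun j => ?_
    rw [(finCongr e'.symm).surjective.forall]
    refine forall_congr' fun s => ?_
    have h1 := firstOccurrence_comp e' (f.A j) (f.A j).injective
      (fun r => τ.act r (f.N.symm j)) s
    change _ ↔ _ = firstOccurrence
      (fun r : Fin (E.T + 1) => f.A j (τ.act (r.cast e'.symm) (f.N.symm j))) s
    rw [h1, pull_A_val f.toBij g rfl]
    rfl
  · rw [f.N.symm.surjective.forall]
    refine forall_congr' fun j => ?_
    rw [(finCongr e.symm).surjective.forall]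
    refine forall_congr' fun s => ?_
    have h1 := firstOccurrence_comp e (f.Ob j) (f.Ob j).injective
      (fun r => τ.obs r (f.N.symm j)) s
    change _ ↔ _ = firstOccurrence
      (fun r : Fin E.T => f.Ob j (τ.obs (r.cast e.symm) (f.N.symm j))) s
    rw [h1, pull_Ob_val f.toBij g rfl]
    rfl

end Labeling

/-- Two Dec-POMDPs on the same sets that are isomorphic by identities are equal. -/
lemma hashArg_eq_of_iso (h : Iso L L') (hN : ∀ i, (h.N i : ℕ) = i) (hS : L.S = L'.S)
    (hs : ∀ s, HEq (h.S s) s) (hA : ∀ i j, h.N.symm j = i → L.A i = L'.A j)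
    (ha : ∀ i j (e : h.N.symm j = i) a, HEq (h.fA e a) a)
    (hO : ∀ i j, h.N.symm j = i → L.Ob i = L'.Ob j)
    (ho : ∀ i j (e : h.N.symm j = i) o, HEq (h.fO e o) o) (τ : Episode L) :
    (⟨L, τ⟩ : HashArg) = ⟨L', h.onEpisode τ⟩ := by
  obtain ⟨⟨N, hpos, S, A, Ob, _, _, _, _⟩, P, R, O, b, T⟩ := L
  obtain ⟨⟨N', hpos', S', A', Ob', _, _, _, _⟩, P', R', O', b', T'⟩ := L'
  obtain ⟨⟨n, s, a, o⟩, hT, hP, hOb, hR, hb⟩ := h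
  dsimp only at n s a o hN hS hs hA hO hT
  obtain rfl : N = N' := Fin.equiv_iff_eq.1 ⟨n⟩
  obtain rfl : n = Equiv.refl _ := Equiv.ext fun i => Fin.ext (hN i)
  subst hS
  obtain rfl : A = A' := funext fun i => hA i i rfl
  obtain rfl : Ob = Ob' := funext fun i => hO i i rfl
  subst hT
  obtain rfl : s = Equiv.refl _ := Equiv.ext fun x => eq_of_heq (hs x)
  obtain rfl : a = fun _ => Equiv.refl _ :=
    funext fun i => Equiv.ext fun x => eq_of_heq (ha i i rfl x)
  obtain rfl : o = fun _ => Equiv.refl _ :=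
    funext fun i => Equiv.ext fun x => eq_of_heq (ho i i rfl x)
  obtain rfl : P = P' := funext fun s => funext fun a => PMF.ext fun s' => hP s a s'
  obtain rfl : O = O' := funext fun s => funext fun a => PMF.ext fun o => hOb s a o
  obtain rfl : R = R' := funext fun s => funext fun a => hR s a
  obtain rfl : b = b' := PMF.ext hb
  rfl

/-- Once the target models coincide, `f` followed by the inverse of `g` is an automorphism. This
controls all collisions of hash arguments. -/
lemma exists_aut_of_hashArg_eq (f : Iso D L) (g : Iso D L') (τ τ' : Episode D)
    (h : (⟨L, f.onEpisode τ⟩ : HashArg) = ⟨L', g.onEpisode τ'⟩) :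
    ∃ φ : Aut D, φ.onEpisode τ = τ' := by
  obtain ⟨rfl, h⟩ := Sigma.mk.inj h
  refine ⟨f.comp g.inv, ?_⟩
  rw [Iso.onEpisode_comp, eq_of_heq h]
  exact g.episodeEquiv.left_inv τ'

/-- Undoing `k`, applying `f` and then `g` is an isomorphism of the relabeled models that fixes
every label, so the two arguments are equal and not merely isomorphic. This is essential, as a hash
function need not respect isomorphism. -/
lemma hashArg_pull (f : Iso D E) (g : Labeling E.toFrame) (τ : Episode D) :
    (⟨(g.pull f.toBij).relabel D, (g.pull f.toBij).onEpisode τ⟩ : HashArg) =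
      ⟨g.relabel E, g.onEpisode (f.onEpisode τ)⟩ := by
  let k : Labeling D.toFrame := g.pull f.toBij
  let h : Iso (k.relabel D) (g.relabel E) := (k.toIso D).inv.comp (f.comp (g.toIso E))
  have hτ : g.onEpisode (f.onEpisode τ) = h.onEpisode (k.onEpisode τ) := by
    change _ = (g.toIso E).onEpisode (f.onEpisode ((k.toIso D).inv.onEpisode
      ((k.toIso D).onEpisode τ)))
    rw [show (k.toIso D).inv.onEpisode ((k.toIso D).onEpisode τ) = τ from
      (k.toIso D).episodeEquiv.left_inv τ]
    rfl
  rw [hτ]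
  have hN : ∀ i j, h.N.symm j = i → f.N.symm (g.N.symm j) = k.N.symm i := by
    intro i j e
    rw [← e]
    exact (k.N.symm_apply_apply _).symm
  refine hashArg_eq_of_iso h ?_ ?_ ?_ ?_ ?_ ?_ ?_ _
  · intro i
    obtain ⟨i, rfl⟩ := k.N.surjective i
    change (g.N (f.N (k.N.symm (k.N i))) : ℕ) = _
    rw [Equiv.symm_apply_apply]
    rfl
  · exact congrArg Fin (Nat.card_congr f.S)
  · intro s
    obtain ⟨s, rfl⟩ := k.S.surjective s
    change HEq (g.S (f.S (k.S.symm (k.S s)))) (k.S s)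
    rw [Equiv.symm_apply_apply]
    exact (Fin.heq_ext_iff (Nat.card_congr f.S).symm).2 rfl
  · intro i j e
    have := Nat.card_congr (h.fA e)
    change Nat.card (Fin _) = Nat.card (Fin _) at this
    rw [Nat.card_fin, Nat.card_fin] at this
    exact congrArg Fin this
  · intro i j e a
    have hc := Nat.card_congr (h.fA e)
    change Nat.card (Fin _) = Nat.card (Fin _) at hc
    rw [Nat.card_fin, Nat.card_fin] at hc
    refine (Fin.heq_ext_iff hc.symm).2 ?_
    obtain ⟨a, rfl⟩ := (k.toBij.fA (i := k.N.symm i) (j := i) rfl).surjective a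
    have he : h.fA e (k.toBij.fA (i := k.N.symm i) (j := i) rfl a) =
        g.toBij.fA (i := g.N.symm j) (j := j) rfl (f.fA (hN i j e) a) :=
      Bij.conj_fA k.toBij f.toBij g.toBij rfl (hN i j e) rfl e a
    rw [he]
    refine (g.toBij_fA_val rfl _).trans (Eq.trans ?_ (k.toBij_fA_val (j := i) rfl a).symm)
    exact (Labeling.pull_A_val f.toBij g (hN i j e) a).symm
  · intro i j e
    have := Nat.card_congr (h.fO e)
    change Nat.card (Fin _) = Nat.card (Fin _) at this
    rw [Nat.card_fin, Nat.card_fin] at this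
    exact congrArg Fin this
  · intro i j e o
    have hc := Nat.card_congr (h.fO e)
    change Nat.card (Fin _) = Nat.card (Fin _) at hc
    rw [Nat.card_fin, Nat.card_fin] at hc
    refine (Fin.heq_ext_iff hc.symm).2 ?_
    obtain ⟨o, rfl⟩ := (k.toBij.fO (i := k.N.symm i) (j := i) rfl).surjective o
    have he : h.fO e (k.toBij.fO (i := k.N.symm i) (j := i) rfl o) =
        g.toBij.fO (i := g.N.symm j) (j := j) rfl (f.fO (hN i j e) o) :=
      Bij.conj_fO k.toBij f.toBij g.toBij rfl (hN i j e) rfl e o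
    rw [he]
    refine (g.toBij_fO_val rfl _).trans (Eq.trans ?_ (k.toBij_fO_val (j := i) rfl o).symm)
    exact (Labeling.pull_Ob_val f.toBij g (hN i j e) o).symm

/-! ### Invariance of `chi` under isomorphism -/

/-- The mean of the hash values over the labelings that put a history in normal form. -/
def meanHash (η : HashArg → ℝ) (τ : Episode D) : ℝ :=
  Finset.expect (normalLabelings τ) (fun f => η ⟨f.relabel D, f.onEpisode τ⟩)

lemma meanHash_onEpisode (η : HashArg → ℝ) (f : Iso D E) (τ : Episode D) :
    meanHash η (f.onEpisode τ) = meanHash η τ := by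
  refine Finset.expect_equiv (Equiv.ofBijective _ (Labeling.pull_bijective f.toBij)) ?_ ?_
  · intro g
    exact (Labeling.pull_mem_normalLabelings f g τ).symm
  · intro g _
    exact congrArg η (hashArg_pull f g τ).symm

lemma card_normalLabelings_onEpisode (f : Iso D E) (τ : Episode D) :
    (normalLabelings (f.onEpisode τ)).card = (normalLabelings τ).card :=
  Finset.card_equiv (Equiv.ofBijective _ (Labeling.pull_bijective f.toBij)) fun g =>
    (Labeling.pull_mem_normalLabelings f g τ).symm

lemma chi_congr (η : HashArg → ℝ) {π π' : Policy D} (h : symmetrizer π = symmetrizer π') :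
    chi η D π = chi η D π' := by
  unfold chi
  rw [h]

lemma chi_pushPolicy (η : HashArg → ℝ) (f : Iso D E) (π : Policy D) :
    chi η E (pushPolicy f π) = chi η D π := by
  unfold chi
  rw [symmetrizer_pushPolicy, ← Equiv.sum_comp f.episodeEquiv]
  refine Finset.sum_congr rfl fun τ _ => ?_
  change (prob _ _ (f.onEpisode τ)).toReal * meanHash η (f.onEpisode τ) = _
  rw [prob_onEpisode, meanHash_onEpisode]
  rfl

lemma isIsoInvariant_chi (𝒟 : Set DecPOMDP) (η : HashArg → ℝ) : IsIsoInvariant 𝒟 (chi η) := by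
  intro D _ E _ f π π' h
  have h' : symmetrizer (pushPolicy f π) = symmetrizer π' := Quotient.exact h
  rw [← chi_pushPolicy η f π, chi_congr η h']

end

section

/-! ### Total probability -/

variable {D : DecPOMDP}

lemma tsum_prod_pmf {ι : Type} [Fintype ι] {A : ι → Type} [∀ i, Finite (A i)]
    (p : ∀ i, PMF (A i)) : ∑' a : ∀ i, A i, ∏ i, p i (a i) = 1 := by
  classical
  let _ : ∀ i, Fintype (A i) := fun i => Fintype.ofFinite _
  rw [tsum_fintype]
  have h := Finset.prod_univ_sum (fun i => (Finset.univ : Finset (A i))) (fun i a => p i a)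
  rw [Fintype.piFinset_univ] at h
  rw [← h]
  refine Finset.prod_eq_one fun i _ => ?_
  exact (tsum_fintype _).symm.trans (PMF.tsum_coe (p i))

/-- One layer of an iterated sum over successive random draws. -/
lemma tsum_pmf_mul {α β : Type} (p : PMF α) {K : α → β → ℝ≥0∞} (hK : ∀ x, ∑' y, K x y = 1) :
    ∑' q : α × β, p q.1 * K q.1 q.2 = 1 := by
  rw [ENNReal.tsum_prod (f := fun x y => p x * K x y), ← p.tsum_coe]
  refine tsum_congr fun x => ?_
  rw [ENNReal.tsum_mul_left, hK, mul_one]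

open Classical in
lemma tsum_act_rew (p : ∀ i, PMF (D.A i)) (s : D.S) :
    ∑' q : D.JointA × Set.range (fun q : D.S × D.JointA => D.R q.1 q.2),
      (∏ i, p i (q.1 i)) * (if (q.2 : ℝ) = D.R s q.1 then 1 else 0) = 1 := by
  refine ENNReal.tsum_prod'.trans (Eq.trans (tsum_congr fun a => ?_) (tsum_prod_pmf p))
  dsimp only
  rw [ENNReal.tsum_mul_left, tsum_eq_single ⟨D.R s a, ⟨(s, a), rfl⟩⟩]
  · simp
  · intro r hr
    rw [if_neg fun h => hr (Subtype.ext h)]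

/-- Forget the last step of a history. -/
def History.trunc {t : ℕ} (h : History D (t + 1)) : History D t where
  state s := h.state s.castSucc
  act s := h.act s.castSucc
  rew s := h.rew s.castSucc
  obs s := h.obs s.castSucc

/-- Action-observation histories extended by a joint observation. -/
def History.aoSnoc {t : ℕ} (h : History D t) (o : D.JointO) (i : Fin D.N) :
    Fin (t + 1) → D.A i × D.Ob i :=
  fun r => (h.act r i, (Fin.snoc (α := fun _ => D.JointO) h.obs o : Fin (t + 1) → D.JointO) r i)

lemma History.ao_eq_aoSnoc {t : ℕ} (h : History D (t + 1)) (i : Fin D.N) :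
    h.ao i (t + 1) le_rfl = h.trunc.aoSnoc (h.obs (Fin.last t)) i := by
  have h' : (Fin.snoc (α := fun _ => D.JointO) h.trunc.obs (h.obs (Fin.last t)) :
      Fin (t + 1) → D.JointO) = h.obs := Fin.snoc_init_self h.obs
  funext r
  unfold aoSnoc
  rw [h']
  rfl

open Classical in
lemma prob_succ (π : Policy D) {t : ℕ} (ht : t + 1 ≤ D.T) (h : History D (t + 1)) :
    prob π ht h = prob π (Nat.le_of_succ_le ht) h.trunc *
      (D.P (h.trunc.state (Fin.last t)) (h.trunc.act (Fin.last t)) (h.state (Fin.last _)) *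
      (D.O (h.state (Fin.last _)) (h.trunc.act (Fin.last t)) (h.obs (Fin.last t)) *
      ((∏ i, π i (t + 1) ht (h.trunc.aoSnoc (h.obs (Fin.last t)) i) (h.act (Fin.last _) i)) *
        (if (h.rew (Fin.last _) : ℝ) = D.R (h.state (Fin.last _)) (h.act (Fin.last _))
          then 1 else 0)))) := by
  have e : ∀ x y z u v w : ℝ≥0∞,
      x * (y * (z * u)) * (v * w) = x * y * v * (z * (u * w)) := fun x y z u v w => by ring
  simp only [← History.ao_eq_aoSnoc]
  unfold prob
  refine Eq.trans (congrArg₂ _ (congrArg₂ _ rfl (Fin.prod_univ_castSucc _))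
    (Fin.prod_univ_castSucc _)) ?_
  exact e _ _ _ _ _ _

-- Induction on the length, summing out reward, action, observation and state of the last step. An
-- upper bound is enough for the range of `chi`, so the decomposition `φ` into past and last step
-- only has to be injective.
open Classical in
lemma tsum_prob_le_one (π : Policy D) {t : ℕ} (ht : t ≤ D.T) :
    ∑' h : History D t, prob π ht h ≤ 1 := by
  induction t with
  | zero =>
    let φ : History D 0 → D.S × D.JointA × Set.range (fun q : D.S × D.JointA => D.R q.1 q.2) :=
      fun h => (h.state 0, h.act 0, h.rew 0)
    let G : D.S × D.JointA × Set.range (fun q : D.S × D.JointA => D.R q.1 q.2) → ℝ≥0∞ :=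
      fun q => D.b₀ q.1 * ((∏ i, π i 0 ht Fin.elim0 (q.2.1 i)) *
        (if (q.2.2 : ℝ) = D.R q.1 q.2.1 then 1 else 0))
    have hφ : Function.Injective φ := by
      intro h h' e
      simp only [φ, Prod.mk.injEq] at e
      obtain ⟨e1, e2, e3⟩ := e
      ext1 s
      · rw [Fin.fin_one_eq_zero s, e1]
      · rw [Fin.fin_one_eq_zero s, e2]
      · rw [Fin.fin_one_eq_zero s, e3]
      · exact s.elim0
    have hG : ∀ h, prob π ht h = G (φ h) := by
      intro h
      unfold prob
      rw [Fin.prod_univ_zero, mul_one]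
      refine congrArg₂ _ rfl ((Fin.prod_univ_one _).trans (congrArg₂ _
        (Finset.prod_congr rfl fun i _ => ?_) rfl))
      exact congrArg (fun τ => π i 0 ht τ (h.act 0 i)) (Subsingleton.elim _ _)
    calc ∑' h, prob π ht h = ∑' h, G (φ h) := tsum_congr hG
      _ ≤ ∑' q, G q := ENNReal.tsum_comp_le_tsum_of_injective hφ G
      _ = 1 := tsum_pmf_mul D.b₀ fun s => tsum_act_rew (fun i => π i 0 ht Fin.elim0) s
  | succ t ih =>
    have ht' := Nat.le_of_succ_le ht
    let φ : History D (t + 1) → History D t × D.S × D.JointO × D.JointA ×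
        Set.range (fun q : D.S × D.JointA => D.R q.1 q.2) :=
      fun h => (h.trunc, h.state (Fin.last _), h.obs (Fin.last _), h.act (Fin.last _),
        h.rew (Fin.last _))
    let G : History D t × D.S × D.JointO × D.JointA ×
        Set.range (fun q : D.S × D.JointA => D.R q.1 q.2) → ℝ≥0∞ :=
      fun q => prob π ht' q.1 * (D.P (q.1.state (Fin.last t)) (q.1.act (Fin.last t)) q.2.1 *
        (D.O q.2.1 (q.1.act (Fin.last t)) q.2.2.1 *
        ((∏ i, π i (t + 1) ht (q.1.aoSnoc q.2.2.1 i) (q.2.2.2.1 i)) *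
          (if (q.2.2.2.2 : ℝ) = D.R q.2.1 q.2.2.2.1 then 1 else 0))))
    have hφ : Function.Injective φ := by
      intro h h' e
      simp only [φ, Prod.mk.injEq] at e
      obtain ⟨e0, e1, e2, e3, e4⟩ := e
      ext1 s
      · exact Fin.lastCases e1 (fun s => congrFun (congrArg History.state e0) s) s
      · exact Fin.lastCases e3 (fun s => congrFun (congrArg History.act e0) s) s
      · exact congrArg Subtype.val
          (Fin.lastCases (motive := fun s => h.rew s = h'.rew s) e4
            (fun s => congrFun (congrArg History.rew e0) s) s)
      · exact Fin.lastCases e2 (fun s => congrFun (congrArg History.obs e0) s) s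
    calc ∑' h, prob π ht h = ∑' h, G (φ h) := tsum_congr (prob_succ π ht)
      _ ≤ ∑' q, G q := ENNReal.tsum_comp_le_tsum_of_injective hφ G
      _ = ∑' h : History D t, prob π ht' h := by
        rw [ENNReal.tsum_prod']
        refine tsum_congr fun h => ?_
        refine (ENNReal.tsum_mul_left (a := prob π ht' h)).trans
          ((congrArg₂ _ rfl ?_).trans (mul_one _))
        exact tsum_pmf_mul (D.P (h.state (Fin.last t)) (h.act (Fin.last t))) fun s =>
          tsum_pmf_mul (D.O s (h.act (Fin.last t))) fun o =>
            tsum_act_rew (fun i => π i (t + 1) ht (h.aoSnoc o i)) s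
      _ ≤ 1 := ih ht'

lemma prob_ne_top (π : Policy D) {t : ℕ} (ht : t ≤ D.T) (h : History D t) : prob π ht h ≠ ⊤ :=
  ne_top_of_le_ne_top ENNReal.one_ne_top (prob_le_one π ht h)

lemma sum_toReal_prob_le_one (π : Policy D) {t : ℕ} (ht : t ≤ D.T) :
    ∑ h : History D t, (prob π ht h).toReal ≤ 1 := by
  rw [← ENNReal.toReal_sum fun h _ => prob_ne_top π ht h]
  have h := tsum_prob_le_one π ht
  rw [tsum_fintype] at h
  exact ENNReal.toReal_le_of_le_ofReal zero_le_one (by simpa using h)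

lemma chi_mem_Icc {𝒟 : Set DecPOMDP} {η : HashArg → ℝ}
    (hη : ∀ x ∈ hashArgs 𝒟, η x ∈ Set.Icc (0 : ℝ) 1) (hD : D ∈ 𝒟) (π : Policy D) :
    chi η D π ∈ Set.Icc (0 : ℝ) 1 := by
  have hmem : ∀ (τ : Episode D) (f : Labeling D.toFrame),
      η ⟨f.relabel D, f.onEpisode τ⟩ ∈ Set.Icc (0 : ℝ) 1 := fun τ f => hη _ ⟨D, hD, f, rfl⟩
  have h0 : ∀ τ : Episode D, 0 ≤ meanHash η τ := fun τ =>
    Finset.expect_nonneg fun f _ => (hmem τ f).1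
  have h1 : ∀ τ : Episode D, meanHash η τ ≤ 1 := fun τ =>
    Finset.expect_le (normalLabelings_nonempty τ) fun f _ => (hmem τ f).2
  constructor
  · exact Finset.sum_nonneg fun τ _ => mul_nonneg ENNReal.toReal_nonneg (h0 τ)
  · refine le_trans (Finset.sum_le_sum fun τ _ => ?_) (sum_toReal_prob_le_one (symmetrizer π) le_rfl)
    exact mul_le_of_le_one_right ENNReal.toReal_nonneg (h1 τ)

end

section

/-! ### Almost sure separation -/

/-- If `X` has no atoms and is independent of `Y`, then almost surely `X ≠ Y`. -/
lemma ae_ne_of_indepFun {Ω : Type*} [MeasurableSpace Ω] {μ : Measure Ω} [IsProbabilityMeasure μ]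
    {X Y : Ω → ℝ} (hX : Measurable X) (hY : Measurable Y) (hXY : IndepFun X Y μ)
    (hatoms : ∀ c : ℝ, μ {ω | X ω = c} = 0) : ∀ᵐ ω ∂μ, X ω ≠ Y ω := by
  have hdiag : MeasurableSet {p : ℝ × ℝ | p.1 = p.2} := measurableSet_eq_fun measurable_fst measurable_snd
  have hmap := (indepFun_iff_map_prod_eq_prod_map_map hX.aemeasurable hY.aemeasurable).1 hXY
  have hpY := Measure.isProbabilityMeasure_map (μ := μ) hY.aemeasurable
  have hpX := Measure.isProbabilityMeasure_map (μ := μ) hX.aemeasurable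
  rw [ae_iff]
  have h1 : {ω | ¬ X ω ≠ Y ω} = (fun ω => (X ω, Y ω)) ⁻¹' {p : ℝ × ℝ | p.1 = p.2} := by
    ext ω; simp
  rw [h1, ← Measure.map_apply (hX.prodMk hY) hdiag, hmap, Measure.prod_apply_symm hdiag]
  rw [lintegral_eq_zero_iff' (measurable_measure_prodMk_right hdiag).aemeasurable]
  -- By Fubini it suffices to look at one value of `Y`: the slice of the diagonal is a single point,
  -- hence null for the law of `X`.
  refine Filter.Eventually.of_forall fun y => ?_
  have h2 : (fun x => (x, y)) ⁻¹' {p : ℝ × ℝ | p.1 = p.2} = {y} := by ext x; simp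
  simp only [h2, Pi.zero_apply]
  rw [Measure.map_apply hX (measurableSet_singleton y)]
  exact hatoms y

/-- A non-trivial linear combination of independent random variables without atoms is almost surely
non-zero. -/
lemma ae_sum_mul_ne_zero {Ω ι : Type*} [MeasurableSpace Ω] {μ : Measure Ω} [IsProbabilityMeasure μ]
    {X : ι → Ω → ℝ} (hX : ∀ i, Measurable (X i)) (hind : iIndepFun X μ)
    (hatoms : ∀ i (c : ℝ), μ {ω | X i ω = c} = 0) (s : Finset ι) (c : ι → ℝ) {i : ι} (hi : i ∈ s)
    (hc : c i ≠ 0) : ∀ᵐ ω ∂μ, ∑ j ∈ s, c j * X j ω ≠ 0 := by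
  classical
  have hcX : ∀ j, Measurable fun ω => c j * X j ω := fun j => (hX j).const_mul (c j)
  have hind' : iIndepFun (fun j ω => c j * X j ω) μ :=
    hind.comp (fun j x => c j * x) fun j => measurable_const_mul (c j)
  have hsum : Measurable fun ω => ∑ j ∈ s.erase i, c j * X j ω :=
    Finset.measurable_sum _ fun j _ => hcX j
  have h2 : IndepFun (fun ω => c i * X i ω) (fun ω => ∑ j ∈ s.erase i, c j * X j ω) μ := by
    have := (hind'.indepFun_finsetSum_of_notMem hcX (Finset.notMem_erase i s)).symm
    have e : (∑ j ∈ s.erase i, fun ω => c j * X j ω) = fun ω => ∑ j ∈ s.erase i, c j * X j ω := by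
      funext ω; simp
    rwa [e] at this
  have h3 : IndepFun (fun ω => c i * X i ω) (fun ω => -∑ j ∈ s.erase i, c j * X j ω) μ :=
    h2.comp measurable_id measurable_neg
  -- If the sum vanished, the `i`-th term would equal minus the rest, which is independent of it;
  -- the `i`-th term has no atoms because `c i ≠ 0`.
  filter_upwards [ae_ne_of_indepFun (hcX i) hsum.neg h3 fun d => by
    simpa only [eq_div_iff hc, mul_comm] using hatoms i (d / c i)] with ω hω h0
  rw [← Finset.add_sum_erase _ _ hi] at h0
  exact hω (eq_neg_of_add_eq_zero_left h0)

variable {D : DecPOMDP}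

/-- The argument at which the hash function is evaluated for a history and a labeling, as an element
of `hashArgs 𝒟`. -/
def labeledArg {𝒟 : Set DecPOMDP} (hD : D ∈ 𝒟) (q : Σ _ : Episode D, Labeling D.toFrame) :
    hashArgs 𝒟 :=
  ⟨⟨q.2.relabel D, q.2.onEpisode q.1⟩, D, hD, q.2, rfl⟩

/-- The pairs of a history and a labeling that puts it in normal form. -/
def normalPairs (D : DecPOMDP) : Finset (Σ _ : Episode D, Labeling D.toFrame) :=
  Finset.univ.sigma fun τ => normalLabelings τ

/-- The coefficient of a pair in the difference of the values of `χ^#` at two policies. -/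
def diffCoeff (π π' : Policy D) (τ : Episode D) : ℝ :=
  ((prob (symmetrizer π) le_rfl τ).toReal - (prob (symmetrizer π') le_rfl τ).toReal) /
    (normalLabelings τ).card

lemma diffCoeff_onEpisode (π π' : Policy D) (φ : Aut D) (τ : Episode D) :
    diffCoeff π π' (φ.onEpisode τ) = diffCoeff π π' τ := by
  unfold diffCoeff
  rw [prob_symmetrizer_onEpisode, prob_symmetrizer_onEpisode, card_normalLabelings_onEpisode]

-- Terms are grouped by hash argument, because independence is available only for distinct arguments
-- while several pairs may share one.
open Classical in
lemma chi_sub_chi {𝒟 : Set DecPOMDP} (hD : D ∈ 𝒟) (η : HashArg → ℝ) (π π' : Policy D) :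
    chi η D π - chi η D π' = ∑ x ∈ (normalPairs D).image (labeledArg hD),
      (∑ q ∈ (normalPairs D).filter fun q => labeledArg hD q = x, diffCoeff π π' q.1) * η x := by
  have h1 : chi η D π - chi η D π' =
      ∑ q ∈ normalPairs D, diffCoeff π π' q.1 * η (labeledArg hD q) := by
    unfold chi normalPairs
    rw [← Finset.sum_sub_distrib, Finset.sum_sigma]
    refine Finset.sum_congr rfl fun τ _ => ?_
    refine Eq.trans ?_ (Finset.mul_sum (normalLabelings τ)
      (fun f => η (labeledArg hD ⟨τ, f⟩)) (diffCoeff π π' τ))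
    rw [← sub_mul, Finset.expect_eq_sum_div_card, diffCoeff, mul_div_assoc', div_mul_eq_mul_div]
    rfl
  rw [h1, ← Finset.sum_fiberwise_of_maps_to (g := labeledArg hD)
    (fun q hq => Finset.mem_image_of_mem _ hq)]
  refine Finset.sum_congr rfl fun x _ => ?_
  rw [Finset.sum_mul]
  refine Finset.sum_congr rfl fun q hq => ?_
  rw [(Finset.mem_filter.1 hq).2]

lemma ae_chi_ne {𝒟 : Set DecPOMDP} {Ω : Type*} [MeasurableSpace Ω] {μ : Measure Ω}
    [IsProbabilityMeasure μ] {hash : HashArg → Ω → ℝ} (hhash : IsRandomHash 𝒟 μ hash)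
    (hD : D ∈ 𝒟) (hdet : HistoriesDetermine D) {π π' : Policy D} (hne : ¬ policySetoid D π π') :
    ∀ᵐ ω ∂μ, chi (fun x => hash x ω) D π ≠ chi (fun x => hash x ω) D π' := by
  classical
  obtain ⟨τ, hτ⟩ : ∃ τ : Episode D,
      prob (symmetrizer π) le_rfl τ ≠ prob (symmetrizer π') le_rfl τ := by
    by_contra! h
    exact hne (hdet π π' h)
  obtain ⟨f, hf⟩ := normalLabelings_nonempty τ
  have hcard : ((normalLabelings τ).card : ℝ) ≠ 0 :=
    Nat.cast_ne_zero.2 (Finset.card_ne_zero_of_mem hf)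
  have hw : diffCoeff π π' τ ≠ 0 := by
    refine div_ne_zero (sub_ne_zero.2 fun h => hτ ?_) hcard
    exact (ENNReal.toReal_eq_toReal_iff' (prob_ne_top _ _ _) (prob_ne_top _ _ _)).1 h
  have hmem : (⟨τ, f⟩ : Σ _ : Episode D, Labeling D.toFrame) ∈ normalPairs D :=
    Finset.mem_sigma.2 ⟨Finset.mem_univ _, hf⟩
  have hc : ∑ q ∈ (normalPairs D).filter fun q => labeledArg hD q = labeledArg hD ⟨τ, f⟩,
      diffCoeff π π' q.1 ≠ 0 := by
    -- No cancellation within a fibre: histories in it are related by automorphisms, so its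
    -- coefficients are all equal to that of `τ`.
    rw [Finset.sum_congr rfl (g := fun _ => diffCoeff π π' τ), Finset.sum_const, nsmul_eq_mul]
    · refine mul_ne_zero (Nat.cast_ne_zero.2 (Finset.card_ne_zero_of_mem (a := ⟨τ, f⟩) ?_)) hw
      exact Finset.mem_filter.2 ⟨hmem, rfl⟩
    · rintro ⟨τ', f'⟩ hq
      obtain ⟨φ, rfl⟩ := exists_aut_of_hashArg_eq (f.toIso D) (f'.toIso D) τ τ'
        (congrArg Subtype.val (Finset.mem_filter.1 hq).2).symm
      exact diffCoeff_onEpisode π π' φ τ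
  filter_upwards [ae_sum_mul_ne_zero (X := fun x : hashArgs 𝒟 => hash x)
    (fun x => hhash.measurable x x.2) hhash.indep (fun x => hhash.noAtoms x x.2)
    ((normalPairs D).image (labeledArg hD))
    (fun x => ∑ q ∈ (normalPairs D).filter fun q => labeledArg hD q = x, diffCoeff π π' q.1)
    (Finset.mem_image_of_mem _ hmem) hc] with ω hω h
  exact hω ((chi_sub_chi hD (fun x => hash x ω) π π').symm.trans (sub_eq_zero.2 h))

end

section

/-! ### Existence of other-play optimal policies -/

section Continuity

variable {D E : DecPOMDP} {Z : Type} [TopologicalSpace Z]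

/-- All probabilities `π_i(a ∣ τ)` of a family of policies depend continuously on the parameter. -/
def ContinuousFamily (p : Z → Policy D) : Prop :=
  ∀ i t (ht : t ≤ D.T) (τ : Fin t → D.A i × D.Ob i) (a : D.A i),
    Continuous fun z => (p z i t ht τ a).toReal

lemma ContinuousFamily.pushPolicy {p : Z → Policy D} (hp : ContinuousFamily p) (f : Iso D E) :
    ContinuousFamily fun z => pushPolicy f (p z) := by
  intro j t ht τ a
  obtain ⟨a, rfl⟩ := (f.A j).surjective a
  unfold LFC.pushPolicy
  simp only [Labeling.map_equiv_apply]
  exact hp _ _ _ _ a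

lemma ContinuousFamily.pushProfile {p : Z → Policy D} (hp : ContinuousFamily p)
    (g : Fin D.N → Aut D) : ContinuousFamily fun z => pushProfile g (p z) :=
  fun i => hp.pushPolicy (g i) i

lemma ContinuousFamily.prob {p : Z → Policy D} (hp : ContinuousFamily p) {t : ℕ} (ht : t ≤ D.T)
    (h : History D t) : Continuous fun z => (prob (p z) ht h).toReal := by
  simp only [prob_eq_envProb_mul, pathWeight, ENNReal.toReal_mul, ENNReal.toReal_prod]
  exact continuous_const.mul (continuous_finsetProd _ fun i _ =>
    (continuous_finsetProd _ fun s _ => hp _ _ _ _ _).mul (hp _ _ _ _ _))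

lemma ContinuousFamily.selfPlay {p : Z → Policy D} (hp : ContinuousFamily p) :
    Continuous fun z => selfPlay (p z) :=
  continuous_finsetSum _ fun h _ => (hp.prob le_rfl h).mul continuous_const

lemma ContinuousFamily.otherPlay {p : Z → Policy D} (hp : ContinuousFamily p) :
    Continuous fun z => otherPlay (p z) := by
  unfold LFC.otherPlay
  simp only [Finset.expect_eq_sum_div_card]
  exact (continuous_finsetSum _ fun g _ => (hp.pushProfile g).selfPlay).div_const _

end Continuity

/-- The distribution given by a point of the standard simplex. -/
def simplexPMF {α : Type} [Fintype α] (x : stdSimplex ℝ α) : PMF α :=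
  PMF.ofFintype (fun a => ENNReal.ofReal (x.1 a)) (by
    rw [← ENNReal.ofReal_sum_of_nonneg fun a _ => x.2.1 a, x.2.2, ENNReal.ofReal_one])

lemma toReal_simplexPMF {α : Type} [Fintype α] (x : stdSimplex ℝ α) (a : α) :
    (simplexPMF x a).toReal = x.1 a := by
  simp [simplexPMF, x.2.1 a]

lemma simplexPMF_surjective {α : Type} [Fintype α] :
    Function.Surjective (simplexPMF : stdSimplex ℝ α → PMF α) := by
  intro p
  refine ⟨⟨fun a => (p a).toReal, fun a => ENNReal.toReal_nonneg, ?_⟩, ?_⟩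
  · rw [← ENNReal.toReal_sum fun a _ => p.apply_ne_top a]
    have h := p.tsum_coe
    rw [tsum_fintype] at h
    rw [h, ENNReal.toReal_one]
  · ext a
    simp [simplexPMF, p.apply_ne_top a]

/-- A policy is a point in a product of simplices, which is compact, and the other-play objective is
continuous there. -/
lemma opOptimal_nonempty (D : DecPOMDP) : (opOptimal D).Nonempty := by
  let _ : ∀ i, Fintype (D.A i) := fun i => Fintype.ofFinite _
  have hc : ∀ i, CompactSpace (stdSimplex ℝ (D.A i)) := fun i =>
    isCompact_iff_compactSpace.1 (isCompact_stdSimplex ℝ (D.A i))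
  -- Indexing times by `Fin (D.T + 1)` replaces the proof argument `t ≤ T` of a policy and makes `Q`
  -- an honest product space.
  let Q : Type := ∀ i : Fin D.N, ∀ t : Fin (D.T + 1),
    (Fin t → D.A i × D.Ob i) → stdSimplex ℝ (D.A i)
  let p : Q → Policy D := fun q i t ht τ => simplexPMF (q i ⟨t, Nat.lt_succ_of_le ht⟩ τ)
  have hsurj : Function.Surjective p := by
    intro π
    refine ⟨fun i t τ => Function.surjInv simplexPMF_surjective
      (π i t (Nat.le_of_lt_succ t.2) τ), ?_⟩
    funext i t ht τ
    exact Function.surjInv_eq simplexPMF_surjective _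
  have hp : ContinuousFamily p := by
    intro i t ht τ a
    simp only [p, toReal_simplexPMF]
    exact (continuous_apply a).comp (continuous_subtype_val.comp ((continuous_apply τ).comp
      ((continuous_apply (⟨t, Nat.lt_succ_of_le ht⟩ : Fin (D.T + 1))).comp (continuous_apply i))))
  obtain ⟨q₀, -⟩ := hsurj (uniformLocal D)
  obtain ⟨q, -, hq⟩ := (isCompact_univ (X := Q)).exists_isMaxOn ⟨q₀, Set.mem_univ _⟩
    hp.otherPlay.continuousOn
  refine ⟨p q, fun π' => ?_⟩
  obtain ⟨q', rfl⟩ := hsurj π'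
  exact hq (Set.mem_univ q')

/-! ### Tie-breaking -/

/-- The setoid of other-play optimal policies induced by `policySetoid`. -/
abbrev opSetoid (D : DecPOMDP) : Setoid (opOptimal D) :=
  (policySetoid D).comap ((↑) : opOptimal D → Policy D)

lemma opSetoid_out {D : DecPOMDP} (ρ : opOptimal D) :
    symmetrizer ((Quotient.mk (opSetoid D) ρ).out : Policy D) = symmetrizer (ρ : Policy D) :=
  Quotient.mk_out (s := opSetoid D) ρ

lemma exists_isMax_chi {D : DecPOMDP} (hfin : FiniteOPClasses D) (η : HashArg → ℝ) :
    ∃ π ∈ opOptimal D, ∀ π' ∈ opOptimal D, chi η D π' ≤ chi η D π := by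
  let c : Quotient (opSetoid D) → ℝ :=
    Quotient.lift (fun π => chi η D π) fun π π' h => chi_congr η h
  obtain ⟨π₀, h₀⟩ := opOptimal_nonempty D
  have : Finite (Quotient (opSetoid D)) := hfin
  have : Nonempty (Quotient (opSetoid D)) :=
    ⟨Quotient.mk _ ⟨π₀, h₀⟩⟩
  obtain ⟨x, hx⟩ := Finite.exists_max c
  induction x using Quotient.inductionOn with
  | h π => exact ⟨π, π.2, fun π' h' => hx (Quotient.mk _ ⟨π', h'⟩)⟩

lemma policySetoid_of_mk_eq {D : DecPOMDP} {ρ σ : opOptimal D}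
    (h : Quotient.mk (opSetoid D) ρ = Quotient.mk (opSetoid D) σ) :
    policySetoid D (ρ : Policy D) (σ : Policy D) :=
  Quotient.exact (s := opSetoid D) h

/-- The exceptional null set depends on the pair of policies, and there can be uncountably many
pairs. One representative per class leaves finitely many. -/
lemma ae_separates_opClasses {𝒟 : Set DecPOMDP} {Ω : Type*} [MeasurableSpace Ω] {μ : Measure Ω}
    [IsProbabilityMeasure μ] {hash : HashArg → Ω → ℝ} (hhash : IsRandomHash 𝒟 μ hash)
    {D : DecPOMDP} (hD : D ∈ 𝒟) (hfin : FiniteOPClasses D) (hdet : HistoriesDetermine D) :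
    ∀ᵐ ω ∂μ, ∀ x y : Quotient (opSetoid D), x ≠ y →
      chi (fun x => hash x ω) D x.out ≠ chi (fun x => hash x ω) D y.out := by
  have : Finite (Quotient (opSetoid D)) := hfin
  refine ae_all_iff.2 fun x => ae_all_iff.2 fun y => ?_
  by_cases hxy : x = y
  · exact Filter.Eventually.of_forall fun ω h => absurd hxy h
  · have hne : ¬ policySetoid D (x.out : Policy D) (y.out : Policy D) := fun h => hxy (by
      rw [← Quotient.out_eq x, ← Quotient.out_eq y]
      exact Quotient.sound (s := opSetoid D) h)
    filter_upwards [ae_chi_ne hhash hD hdet hne] with ω hω _ using hω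

/-- Since `chi` is constant on classes, separating representatives separates all optimal policies.
-/
lemma policySetoid_of_chi_eq {D : DecPOMDP} (η : HashArg → ℝ)
    (hsep : ∀ x y : Quotient (opSetoid D), x ≠ y → chi η D x.out ≠ chi η D y.out)
    (ρ σ : opOptimal D) (h : chi η D ρ = chi η D σ) :
    policySetoid D (ρ : Policy D) (σ : Policy D) := by
  refine policySetoid_of_mk_eq (by_contra fun hne => hsep _ _ hne ?_)
  rw [chi_congr η (opSetoid_out ρ), chi_congr η (opSetoid_out σ), h]

lemma ae_isTieBreaking_chi {𝒟 : Set DecPOMDP} {Ω : Type*} [MeasurableSpace Ω] {μ : Measure Ω}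
    [IsProbabilityMeasure μ] {hash : HashArg → Ω → ℝ} (hhash : IsRandomHash 𝒟 μ hash)
    (hfin : ∀ D ∈ 𝒟, FiniteOPClasses D) (hdet : ∀ D ∈ 𝒟, HistoriesDetermine D)
    {𝒞 : Set DecPOMDP} (h𝒞 : 𝒞 ⊆ 𝒟) (hcount : 𝒞.Countable) :
    ∀ᵐ ω ∂μ, IsTieBreaking 𝒞 (chi fun x => hash x ω) := by
  refine (ae_ball_iff hcount).2 fun D hD => ?_
  filter_upwards [ae_separates_opClasses hhash (h𝒞 hD) (hfin D (h𝒞 hD)) (hdet D (h𝒞 hD))]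
    with ω hω
  exact ⟨exists_isMax_chi (hfin D (h𝒞 hD)) _,
    fun π hπ π' hπ' h => policySetoid_of_chi_eq _ hω ⟨π, hπ⟩ ⟨π', hπ'⟩ h⟩

end

end LFC

end

theorem mainTheorem7 (𝒟 : Set LFC.DecPOMDP) {Ω : Type*} [MeasurableSpace Ω]
    (μ : MeasureTheory.Measure Ω) [MeasureTheory.IsProbabilityMeasure μ]
    (hash : LFC.HashArg → Ω → ℝ) (hhash : LFC.IsRandomHash 𝒟 μ hash) :
    -- for every realization, `χ^#` is invariant to isomorphism
    (∀ ω, LFC.IsIsoInvariant 𝒟 (LFC.chi fun x => hash x ω)) ∧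
    -- and it has values in `[0, 1]` if the hash values do
    (∀ ω, (∀ x ∈ LFC.hashArgs 𝒟, hash x ω ∈ Set.Icc (0 : ℝ) 1) →
      ∀ D ∈ 𝒟, ∀ π : LFC.Policy D, LFC.chi (fun x => hash x ω) D π ∈ Set.Icc (0 : ℝ) 1) ∧
    -- any two given non-equivalent policies, optimal or not, are almost surely separated
    ((∀ D ∈ 𝒟, LFC.HistoriesDetermine D) →
      ∀ D ∈ 𝒟, ∀ π π' : LFC.Policy D, ¬ LFC.policySetoid D π π' →
        ∀ᵐ ω ∂μ, LFC.chi (fun x => hash x ω) D π ≠ LFC.chi (fun x => hash x ω) D π') ∧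
    -- `χ^#` is almost surely a tie-breaking function
    ((∀ D ∈ 𝒟, LFC.FiniteOPClasses D) → (∀ D ∈ 𝒟, LFC.HistoriesDetermine D) →
      ∀ 𝒞 ⊆ 𝒟, 𝒞.Countable → ∀ᵐ ω ∂μ, LFC.IsTieBreaking 𝒞 (LFC.chi fun x => hash x ω)) := by
  refine ⟨fun ω => LFC.isIsoInvariant_chi 𝒟 _, fun ω hη D hD π => LFC.chi_mem_Icc hη hD π, ?_, ?_⟩
  · intro hdet D hD π π' hne
    exact LFC.ae_chi_ne hhash hD (hdet D hD) hne
  · intro hfin hdet 𝒞 h𝒞 hcount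
    exact LFC.ae_isTieBreaking_chi hhash hfin hdet h𝒞 hcount
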